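/- Let $\mathbb{K}\in\{\mathbb{C},\mathbb{H}\}$, $d=\dim_{\mathbb{R}}\mathbb{K}$ and $r\ge 2$. The unit scalars $S^{d-1}\subset\mathbb{K}$ act on the unit sphere $S^{dr-1}\subset\mathbb{K}^{r}$ by left multiplication. Let $\mathbb{K}P^{r-1}=S^{dr-1}/S^{d-1}$ be the orbit space, let $\Pi_{\mathbb{K}}:S^{dr-1}\to\mathbb{K}P^{r-1}$ be the projection, and give $\mathbb{K}P^{r-1}$ the Riemannian metric that makes $\Pi_{\mathbb{K}}$ a Riemannian submersion from the round sphere. A hypersurface is a smooth immersion of codimension one of a smooth manifold without boundary; it is oriented if it is equipped with a smooth unit normal vector field $N$ along the immersion, and it is minimal if its mean curvature $H=\sum_i\langle\nabla_{e_i}e_i,N\rangle$ ($\{e_i\}$ an orthonormal basis of the tangent space, $\nabla$ the Levi-Civita connection of the ambient space) vanishes identically. Let $\bar f:\bar M\to\mathbb{K}P^{r-1}$ be a compact oriented minimal hypersurface. Let $$M=\{(x,p)\in\bar M\times S^{dr-1}:\ \bar f(x)=\Pi_{\mathbb{K}}(p)\},\qquad f:M\to S^{dr-1},\quad f(x,p)=p,$$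 so that $f(M)=\Pi_{\mathbb{K}}^{-1}(\bar f(\bar M))$ and $\Pi_{\mathbb{K}}(f(M))=\bar f(\bar M)$ (if $\bar M\subset\mathbb{K}P^{r-1}$ is embedded, this is the preimage $\Pi_{\mathbb{K}}^{-1}(\bar M)$). Then $M$ is a compact smooth submanifold of $\bar M\times S^{dr-1}$ of dimension $dr-2$, the map $f$ is an immersion, it admits a smooth unit normal vector field, and the hypersurface $f$ of $S^{dr-1}$ oriented by this field is minimal. -/

import Mathlib

open Set Metric Module Manifold Topology
open scoped ContDiff Manifold

set_option linter.unusedSectionVars false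

noncomputable section

/-! ## Immersed hypersurfaces of a manifold with a metric

The ambient manifold `N` is modelled on a real normed space `E`, and `g` is a family of inner
products on its tangent spaces. The tangent space of `N` at `y` is, by definition in Mathlib, the
space `E`, a vector being given by its coordinates in the preferred chart at `y`. -/

section Hypersurfaces

variable {E : Type*} [NormedAddCommGroup E] [NormedSpace ℝ E]
  {N : Type*} [TopologicalSpace N] [ChartedSpace E N]
  {m : ℕ} {M : Type*} [TopologicalSpace M] [ChartedSpace (EuclideanSpace ℝ (Fin m)) M]

/-- The coordinate expression `g_y(a, b)`, at the point with coordinates `y`, of the metric `g`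
in the preferred chart at `x₀`. -/
def metricInChart (g : ∀ y : N, TangentSpace 𝓘(ℝ, E) y → TangentSpace 𝓘(ℝ, E) y → ℝ)
    (x₀ : N) (y a b : E) : ℝ :=
  g ((extChartAt 𝓘(ℝ, E) x₀).symm y)
    (mfderiv 𝓘(ℝ, E) 𝓘(ℝ, E) (extChartAt 𝓘(ℝ, E) x₀).symm y a)
    (mfderiv 𝓘(ℝ, E) 𝓘(ℝ, E) (extChartAt 𝓘(ℝ, E) x₀).symm y b)

/-- The Christoffel symbols of the first kind of `g` in the preferred chart at `x₀`:
`Γ(a, b; c) = g(∇_a b, c)` for the Levi-Civita connection `∇` and coordinate vector fields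
`a`, `b`, `c` (fields that are constant in the chart), by the Koszul formula. -/
def christoffel (g : ∀ y : N, TangentSpace 𝓘(ℝ, E) y → TangentSpace 𝓘(ℝ, E) y → ℝ)
    (x₀ : N) (y a b c : E) : ℝ :=
  (fderiv ℝ (fun z => metricInChart g x₀ z b c) y a
    + fderiv ℝ (fun z => metricInChart g x₀ z a c) y b
    - fderiv ℝ (fun z => metricInChart g x₀ z a b) y c) / 2

/-- The second fundamental form of `f : M → N` at `x` in the normal direction `ν`:
`II_ν(v, w) = g(∇_v (df W), ν)`, where `W` is a vector field near `x` with `W(x) = w` (the one that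
is constant in the preferred chart at `x`; for normal `ν` the choice does not matter) and `∇` is
the Levi-Civita connection of `g`. With `F` the map `f` in the preferred charts at `x` and `f x`,
`∇_v (df W) = D²F(v, w) + Γ(DF v, DF w)`. -/
def secondFundamentalForm (g : ∀ y : N, TangentSpace 𝓘(ℝ, E) y → TangentSpace 𝓘(ℝ, E) y → ℝ)
    (f : M → N) (x : M) (ν : TangentSpace 𝓘(ℝ, E) (f x)) (v w : TangentSpace (𝓡 m) x) : ℝ :=
  let F : EuclideanSpace ℝ (Fin m) → E := writtenInExtChartAt (𝓡 m) 𝓘(ℝ, E) x f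
  let p : EuclideanSpace ℝ (Fin m) := extChartAt (𝓡 m) x x
  let y : E := extChartAt 𝓘(ℝ, E) (f x) (f x)
  metricInChart g (f x) y (fderiv ℝ (fun z => fderiv ℝ F z w) p v) ν
    + christoffel g (f x) y (fderiv ℝ F p v) (fderiv ℝ F p w) ν

/-- A smooth immersion: a smooth map with injective differential at every point. -/
def IsSmoothImmersion {E₁ H₁ M₁ E₂ H₂ M₂ : Type*} [NormedAddCommGroup E₁] [NormedSpace ℝ E₁]
    [TopologicalSpace H₁] (I₁ : ModelWithCorners ℝ E₁ H₁) [TopologicalSpace M₁]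
    [ChartedSpace H₁ M₁] [NormedAddCommGroup E₂] [NormedSpace ℝ E₂] [TopologicalSpace H₂]
    (I₂ : ModelWithCorners ℝ E₂ H₂) [TopologicalSpace M₂] [ChartedSpace H₂ M₂]
    (f : M₁ → M₂) : Prop :=
  ContMDiff I₁ I₂ ∞ f ∧ ∀ x, Function.Injective (mfderiv I₁ I₂ f x)

/-- `ν` is a smooth unit normal vector field along `f : M → N`. For an immersion of codimension
one, such a field is an orientation of the hypersurface `f`. -/
structure IsUnitNormalField [IsManifold 𝓘(ℝ, E) 1 N]
    (g : ∀ y : N, TangentSpace 𝓘(ℝ, E) y → TangentSpace 𝓘(ℝ, E) y → ℝ)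
    (f : M → N) (ν : ∀ x : M, TangentSpace 𝓘(ℝ, E) (f x)) : Prop where
  smooth : ContMDiff (𝓡 m) 𝓘(ℝ, E).tangent ∞
    (fun x => (⟨f x, ν x⟩ : TangentBundle 𝓘(ℝ, E) N))
  unit : ∀ x, g (f x) (ν x) (ν x) = 1
  normal : ∀ x (v : TangentSpace (𝓡 m) x),
    g (f x) (mfderiv (𝓡 m) 𝓘(ℝ, E) f x v) (ν x) = 0

/-- `e` is an orthonormal basis of `T_x M` for the metric induced by the immersion `f`. (There are
`m = dim M` vectors, so orthonormality is enough.) -/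
def IsOrthonormalFrameAt (g : ∀ y : N, TangentSpace 𝓘(ℝ, E) y → TangentSpace 𝓘(ℝ, E) y → ℝ)
    (f : M → N) (x : M) (e : Fin m → TangentSpace (𝓡 m) x) : Prop :=
  ∀ i j, g (f x) (mfderiv (𝓡 m) 𝓘(ℝ, E) f x (e i)) (mfderiv (𝓡 m) 𝓘(ℝ, E) f x (e j))
    = if i = j then 1 else 0

/-- The hypersurface `f`, oriented by `ν`, is minimal: its mean curvature
`H = ∑ᵢ g(∇_{eᵢ} eᵢ, ν)`, with `e` an orthonormal basis of the tangent space, is zero at every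
point. -/
def IsMinimalAlong (g : ∀ y : N, TangentSpace 𝓘(ℝ, E) y → TangentSpace 𝓘(ℝ, E) y → ℝ)
    (f : M → N) (ν : ∀ x : M, TangentSpace 𝓘(ℝ, E) (f x)) : Prop :=
  ∀ (x : M) (e : Fin m → TangentSpace (𝓡 m) x), IsOrthonormalFrameAt g f x e →
    ∑ i, secondFundamentalForm g f x (ν x) (e i) (e i) = 0

end Hypersurfaces

/-! ## The scalars -/

/-- The scalars `K`: a normed division ring, with multiplicative norm, whose norm comes from a real
inner product for which the multiplication is real bilinear, of finite real dimension `d`. The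
complex numbers (`d = 2`) and the quaternions (`d = 4`) are declared as instances below. -/
class HopfScalars (K : Type*) [NormedDivisionRing K] [InnerProductSpace ℝ K] : Prop where
  smul_assoc : IsScalarTower ℝ K K
  smul_comm : SMulCommClass ℝ K K
  finite : FiniteDimensional ℝ K

attribute [instance] HopfScalars.smul_assoc HopfScalars.smul_comm HopfScalars.finite

instance : HopfScalars ℂ := ⟨inferInstance, inferInstance, inferInstance⟩

instance : HopfScalars (Quaternion ℝ) := ⟨inferInstance, inferInstance, inferInstance⟩

/-! ## The sphere and the projective space -/

section Projective

variable (K : Type*) [NormedDivisionRing K] [InnerProductSpace ℝ K] [HopfScalars K] (n : ℕ)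

/-- The unit sphere `S^{d(n+1)-1}` of `K^{n+1}`, where `d = dim_ℝ K`. -/
abbrev HSphere : Type _ := sphere (0 : EuclideanSpace K (Fin (n + 1))) 1

/-- The dimension `d(n+1)-1` of the sphere. -/
abbrev sphereDim : ℕ := finrank ℝ K * (n + 1) - 1

instance : Fact (finrank ℝ (EuclideanSpace K (Fin (n + 1))) = sphereDim K n + 1) := by
  have h0 : 0 < finrank ℝ K := finrank_pos
  have h1 : finrank ℝ (EuclideanSpace K (Fin (n + 1))) = finrank ℝ K * (n + 1) := by
    rw [(WithLp.linearEquiv 2 ℝ (Fin (n + 1) → K)).finrank_eq, finrank_pi_fintype]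
    simp [mul_comm]
  have h2 : 0 < finrank ℝ K * (n + 1) := by positivity
  exact ⟨by rw [h1]; simp only [sphereDim]; omega⟩

/-- Two points of the sphere are in the same orbit of the unit scalars `S^{d-1}`, which act by
left multiplication. -/
def orbitSetoid : Setoid (HSphere K n) where
  r p q := ∃ c : K, ‖c‖ = 1 ∧
    (q : EuclideanSpace K (Fin (n + 1))) = c • (p : EuclideanSpace K (Fin (n + 1)))
  iseqv := by
    refine ⟨fun p => ⟨1, by simp, by simp⟩, ?_, ?_⟩
    · rintro p q ⟨c, hc, h⟩
      have : c ≠ 0 := by rintro rfl; simp at hc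
      exact ⟨c⁻¹, by simp [hc], by rw [h, smul_smul, inv_mul_cancel₀ this, one_smul]⟩
    · rintro p q s ⟨c, hc, h⟩ ⟨c', hc', h'⟩
      exact ⟨c' * c, by simp [hc, hc'], by rw [h', h, smul_smul]⟩

/-- The projective space `K P^n = S^{d(n+1)-1} / S^{d-1}`, the space of orbits. -/
def KP : Type _ := Quotient (orbitSetoid K n)

instance : TopologicalSpace (KP K n) := inferInstanceAs (TopologicalSpace (Quotient _))

variable {K n}

/-- The projection `Π : S^{d(n+1)-1} → K P^n` that sends a point to its orbit. -/
def hopf (p : HSphere K n) : KP K n := Quotient.mk (orbitSetoid K n) p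

theorem hopf_surjective : Function.Surjective (hopf (K := K) (n := n)) := Quot.mk_surjective

theorem continuous_hopf : Continuous (hopf (K := K) (n := n)) := continuous_quot_mk

theorem isQuotientMap_hopf : IsQuotientMap (hopf (K := K) (n := n)) := isQuotientMap_quot_mk

theorem hopf_eq_iff (p q : HSphere K n) : hopf p = hopf q ↔ ∃ c : K, ‖c‖ = 1 ∧
    (q : EuclideanSpace K (Fin (n + 1))) = c • (p : EuclideanSpace K (Fin (n + 1))) :=
  Quotient.eq (r := orbitSetoid K n)

/-- The set where the `i`-th homogeneous coordinate does not vanish. -/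
def affineDomain (i : Fin (n + 1)) : Set (KP K n) :=
  {x | Quotient.lift (s := orbitSetoid K n)
    (fun p : HSphere K n => (p : EuclideanSpace K (Fin (n + 1))) i ≠ 0) (by
      rintro p q ⟨c, hc, h⟩
      have : c ≠ 0 := by rintro rfl; simp at hc
      simp [h, this]) x}

/-- The affine coordinates `(p_i⁻¹ p_j)_{j ≠ i}` of the orbit of `p`. -/
def affineCoord (i : Fin (n + 1)) : KP K n → (Fin n → K) :=
  Quotient.lift (s := orbitSetoid K n)
    (fun p j => ((p : EuclideanSpace K (Fin (n + 1))) i)⁻¹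
      * (p : EuclideanSpace K (Fin (n + 1))) (i.succAbove j)) (by
      rintro p q ⟨c, hc, h⟩
      have : c ≠ 0 := by rintro rfl; simp at hc
      ext j
      simp [h, mul_inv_rev, mul_assoc, this])

/-- The vector with `i`-th coordinate `1` and the other coordinates given by `z`. -/
def affineVec (i : Fin (n + 1)) (z : Fin n → K) : EuclideanSpace K (Fin (n + 1)) :=
  WithLp.toLp 2 (i.insertNth (1 : K) z)

@[simp] theorem affineVec_same (i : Fin (n + 1)) (z : Fin n → K) : affineVec i z i = 1 := by
  simp [affineVec]

@[simp] theorem affineVec_succAbove (i : Fin (n + 1)) (z : Fin n → K) (j : Fin n) :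
    affineVec i z (i.succAbove j) = z j := by
  simp [affineVec]

theorem affineVec_ne_zero (i : Fin (n + 1)) (z : Fin n → K) : affineVec i z ≠ 0 := by
  intro h
  have := affineVec_same i z
  rw [h] at this
  simp at this

/-- The vector `affineVec i z`, normalized to length one. -/
def affineSection (i : Fin (n + 1)) (z : Fin n → K) : HSphere K n :=
  ⟨(‖affineVec i z‖⁻¹ : ℝ) • affineVec i z, by
    simp [norm_smul, affineVec_ne_zero]⟩

theorem continuous_affineVec (i : Fin (n + 1)) : Continuous (affineVec (K := K) i) := by
  refine (PiLp.continuous_toLp 2 _).comp ?_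
  exact continuous_const.finInsertNth i continuous_id

theorem continuous_affineSection (i : Fin (n + 1)) : Continuous (affineSection (K := K) i) := by
  refine Continuous.subtype_mk ?_ _
  exact ((continuous_affineVec i).norm.inv₀
    (fun z => norm_ne_zero_iff.2 (affineVec_ne_zero i z))).smul (continuous_affineVec i)

theorem hopf_mem_affineDomain (i : Fin (n + 1)) (p : HSphere K n) :
    hopf p ∈ affineDomain i ↔ (p : EuclideanSpace K (Fin (n + 1))) i ≠ 0 := Iff.rfl

theorem affineCoord_hopf (i : Fin (n + 1)) (p : HSphere K n) (j : Fin n) :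
    affineCoord i (hopf p) j = ((p : EuclideanSpace K (Fin (n + 1))) i)⁻¹
      * (p : EuclideanSpace K (Fin (n + 1))) (i.succAbove j) := rfl

theorem affineSection_apply (i : Fin (n + 1)) (z : Fin n → K) (j : Fin (n + 1)) :
    (affineSection i z : EuclideanSpace K (Fin (n + 1))) j
      = (‖affineVec i z‖⁻¹ : ℝ) • affineVec i z j := rfl

theorem real_smul_eq (c : ℝ) (a : K) : c • a = (c • (1 : K)) * a := by
  rw [smul_mul_assoc, one_mul]

theorem hopf_affineSection (i : Fin (n + 1)) (p : HSphere K n)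
    (hp : (p : EuclideanSpace K (Fin (n + 1))) i ≠ 0) :
    hopf (affineSection i (affineCoord i (hopf p))) = hopf p := by
  have h1 : (p : EuclideanSpace K (Fin (n + 1)))
      = (p : EuclideanSpace K (Fin (n + 1))) i • affineVec i (affineCoord i (hopf p)) := by
    ext j
    rcases Fin.eq_self_or_eq_succAbove i j with rfl | ⟨k, rfl⟩
    · simp
    · simp [affineCoord_hopf, hp]
  set w := affineVec i (affineCoord i (hopf p)) with hw
  have hn : (1 : ℝ) = ‖(p : EuclideanSpace K (Fin (n + 1))) i‖ * ‖w‖ := by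
    rw [← norm_smul, ← h1]; simp
  have hw0 : ‖w‖ ≠ 0 := norm_ne_zero_iff.2 (affineVec_ne_zero _ _)
  rw [hopf_eq_iff]
  refine ⟨(p : EuclideanSpace K (Fin (n + 1))) i * (‖w‖ • (1 : K)), ?_, ?_⟩
  · rw [norm_mul, norm_smul]; simp [← hn]
  · ext j
    conv_lhs => rw [h1]
    rw [PiLp.smul_apply, PiLp.smul_apply, affineSection_apply, ← hw, smul_eq_mul, smul_eq_mul,
      mul_assoc, ← real_smul_eq, smul_smul, mul_inv_cancel₀ hw0, one_smul]

theorem affineCoord_affineSection (i : Fin (n + 1)) (z : Fin n → K) :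
    affineCoord i (hopf (affineSection i z)) = z := by
  have hw0 : ‖affineVec i z‖⁻¹ ≠ 0 := inv_ne_zero (norm_ne_zero_iff.2 (affineVec_ne_zero _ _))
  have h0 : (‖affineVec i z‖⁻¹ • (1 : K)) ≠ 0 := by simp [affineVec_ne_zero]
  ext j
  rw [affineCoord_hopf, affineSection_apply, affineSection_apply, affineVec_same,
    affineVec_succAbove, real_smul_eq _ (z j), inv_mul_cancel_left₀ h0]

/-- The chart of `K P^n` given by the affine coordinates `(p_i⁻¹ p_j)_{j ≠ i}` on the set where
`p_i ≠ 0`. -/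
def affineChart (i : Fin (n + 1)) : OpenPartialHomeomorph (KP K n) (Fin n → K) where
  toFun := affineCoord i
  invFun z := hopf (affineSection i z)
  source := affineDomain i
  target := univ
  map_source' _ _ := mem_univ _
  map_target' z _ := by
    rw [hopf_mem_affineDomain, affineSection_apply, affineVec_same]
    simp [affineVec_ne_zero]
  left_inv' x hx := by
    obtain ⟨p, rfl⟩ := hopf_surjective x
    exact hopf_affineSection i p hx
  right_inv' z _ := affineCoord_affineSection i z
  open_source := by
    rw [← isQuotientMap_hopf.isOpen_preimage]
    have hc : Continuous fun p : HSphere K n => (p : EuclideanSpace K (Fin (n + 1))) i :=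
      (PiLp.continuous_apply 2 _ i).comp continuous_subtype_val
    exact isOpen_ne.preimage hc
  open_target := isOpen_univ
  continuousOn_toFun := by
    have ho : IsOpen (affineDomain i : Set (KP K n)) := by
      rw [← isQuotientMap_hopf.isOpen_preimage]
      have hc : Continuous fun p : HSphere K n => (p : EuclideanSpace K (Fin (n + 1))) i :=
        (PiLp.continuous_apply 2 _ i).comp continuous_subtype_val
      exact isOpen_ne.preimage hc
    rw [isQuotientMap_hopf.continuousOn_isOpen_iff ho]
    refine continuousOn_pi.2 fun j => ?_
    have hc : ∀ k, Continuous fun p : HSphere K n => (p : EuclideanSpace K (Fin (n + 1))) k :=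
      fun k => (PiLp.continuous_apply 2 _ k).comp continuous_subtype_val
    exact ((hc i).continuousOn.inv₀ fun p hp => hp).mul (hc _).continuousOn
  continuousOn_invFun := (continuous_hopf.comp (continuous_affineSection i)).continuousOn

theorem exists_mem_affineDomain (x : KP K n) : ∃ i, x ∈ affineDomain i := by
  obtain ⟨p, rfl⟩ := hopf_surjective x
  by_contra! h
  have h0 : (p : EuclideanSpace K (Fin (n + 1))) = 0 := by
    ext i
    simpa [hopf_mem_affineDomain] using h i
  have := p.2
  rw [mem_sphere_zero_iff_norm, h0] at this
  simp at this

instance : ChartedSpace (Fin n → K) (KP K n) where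
  atlas := range affineChart
  chartAt x := affineChart (exists_mem_affineDomain x).choose
  mem_chart_source x := (exists_mem_affineDomain x).choose_spec
  chart_mem_atlas _ := mem_range_self _

/-- The scalars as a normed algebra over the reals. -/
abbrev scalarAlgebra (K : Type*) [NormedDivisionRing K] [InnerProductSpace ℝ K] [HopfScalars K] :
    NormedAlgebra ℝ K :=
  { Algebra.ofModule (R := ℝ) (A := K) smul_mul_assoc mul_smul_comm with
    norm_smul_le := fun a b => norm_smul_le a b }

instance : IsManifold 𝓘(ℝ, Fin n → K) ∞ (KP K n) := by
  let _ := scalarAlgebra K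
  have _ : CompleteSpace K := FiniteDimensional.complete ℝ K
  have hinv : ∀ a : K, a ≠ 0 → ContDiffAt ℝ ∞ (fun b : K => b⁻¹) a := by
    intro a ha
    have h := contDiffAt_ringInverse (n := ∞) ℝ (Units.mk0 a ha)
    rwa [Ring.inverse_eq_inv'] at h
  refine isManifold_of_contDiffOn _ _ _ ?_
  rintro _ _ ⟨i, rfl⟩ ⟨j, rfl⟩
  have hvec : ∀ k : Fin (n + 1), ContDiff ℝ ∞ fun z : Fin n → K => affineVec i z k := by
    intro k
    rcases Fin.eq_self_or_eq_succAbove i k with rfl | ⟨l, rfl⟩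
    · simpa using contDiff_const
    · simpa using contDiff_apply ℝ K l
  have key : ∀ z : Fin n → K, affineCoord j (hopf (affineSection i z))
      = fun l => (affineVec i z j)⁻¹ * affineVec i z (j.succAbove l) := by
    intro z
    have h0 : (‖affineVec i z‖⁻¹ • (1 : K)) ≠ 0 := by simp [affineVec_ne_zero]
    ext l
    rw [affineCoord_hopf, affineSection_apply, affineSection_apply, real_smul_eq,
      real_smul_eq _ (affineVec i z (j.succAbove l)), mul_inv_rev, mul_assoc,
      inv_mul_cancel_left₀ h0]
  have hmem : ∀ z : Fin n → K, hopf (affineSection i z) ∈ affineDomain j →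
      affineVec i z j ≠ 0 := by
    intro z hz h
    rw [hopf_mem_affineDomain, affineSection_apply, h, smul_zero] at hz
    exact hz rfl
  have main : ContDiffOn ℝ ∞ (fun z : Fin n → K => affineCoord j (hopf (affineSection i z)))
      {z | hopf (affineSection i z) ∈ affineDomain j} := by
    simp only [key]
    refine contDiffOn_pi.2 fun l => ?_
    refine ContDiffOn.mul (fun z hz => ?_) (hvec _).contDiffOn
    exact ((hinv _ (hmem z hz)).comp z (hvec j).contDiffAt).contDiffWithinAt
  refine main.congr_mono (fun z _ => rfl) ?_
  rintro z hz
  exact hz.1.2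

/-! ### The metrics -/

/-- A tangent vector of the sphere as a vector of `K^{n+1}`: the differential of the inclusion. -/
def toAmbient (p : HSphere K n) (u : TangentSpace (𝓡 (sphereDim K n)) p) :
    EuclideanSpace K (Fin (n + 1)) :=
  mfderiv (𝓡 (sphereDim K n)) 𝓘(ℝ, EuclideanSpace K (Fin (n + 1)))
    (fun q : HSphere K n => (q : EuclideanSpace K (Fin (n + 1)))) p u

/-- The round metric of the sphere, induced by the inclusion into `K^{n+1}`. -/
def sphereMetric (p : HSphere K n) (u v : TangentSpace (𝓡 (sphereDim K n)) p) : ℝ :=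
  inner ℝ (toAmbient p u) (toAmbient p v)

/-- `u` is the horizontal lift at `p` of the tangent vector `v` of `K P^n`: it projects to `v`, and
it is orthogonal to the fiber of the projection, whose tangent space is the kernel of the
differential of the projection. -/
def IsHorizontalLift (p : HSphere K n) (v : TangentSpace 𝓘(ℝ, Fin n → K) (hopf p))
    (u : TangentSpace (𝓡 (sphereDim K n)) p) : Prop :=
  mfderiv (𝓡 (sphereDim K n)) 𝓘(ℝ, Fin n → K) hopf p u = v ∧
    ∀ w : TangentSpace (𝓡 (sphereDim K n)) p,
      mfderiv (𝓡 (sphereDim K n)) 𝓘(ℝ, Fin n → K) hopf p w = 0 → sphereMetric p u w = 0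

/-- The horizontal lift at `p` of a tangent vector of `K P^n`. -/
def horizontalLift (p : HSphere K n) (v : TangentSpace 𝓘(ℝ, Fin n → K) (hopf p)) :
    TangentSpace (𝓡 (sphereDim K n)) p :=
  Classical.epsilon (IsHorizontalLift p v)

/-- The metric of `K P^n` that makes the projection of the sphere a Riemannian submersion: the inner
product of two tangent vectors at `x` is that of their horizontal lifts at a point `p` of the orbit
`x`. It does not depend on `p`, as the unit scalars act by isometries. (The tangent spaces at `x`
and at `hopf p = x` are the same, with the same preferred chart.) -/
def projectiveMetric (x : KP K n) (v w : TangentSpace 𝓘(ℝ, Fin n → K) x) : ℝ :=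
  sphereMetric (Quotient.out x : HSphere K n)
    (horizontalLift _ (v : Fin n → K)) (horizontalLift _ (w : Fin n → K))

/-! ### The preimage of a hypersurface -/

/-- The preimage in the sphere of `fbar : Mbar → K P^n`: the pairs `(x, p)` with `fbar x = Π p`,
with the subspace topology of `Mbar × S^{d(n+1)-1}`. If `fbar` is the inclusion of a subset, this is
the usual preimage of this subset. -/
abbrev HopfPreimage {Mbar : Type*} (fbar : Mbar → KP K n) : Type _ :=
  {q : Mbar × HSphere K n // fbar q.1 = hopf q.2}

/-- The map `f : M → S^{d(n+1)-1}`, `(x, p) ↦ p`, of the preimage to the sphere. -/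
def preimageMap {Mbar : Type*} (fbar : Mbar → KP K n) (q : HopfPreimage fbar) : HSphere K n :=
  q.1.2

end Projective

end

/-!
The proof compares the two second fundamental forms through an isometric embedding of the projective
space, so that no connection on it has to be handled.

Let `Q p = p* p` be the matrix with entries `conj(pᵢ) pⱼ`. It is invariant under the unit scalars
and induces a map `Φ` of the projective space to the matrices (`kpStarSq`), with `Φ ∘ Π = Q` on the
sphere `S`. For a vector `b` and a horizontal vector `a` at `p`, that is, `herm a p = 0` for the
`K`-valued Hermitian form, one has `⟪dQ b, dQ a⟫ = 2 ⟪b, a⟫`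
(`inner_starSqDeriv_starSqDeriv`). Hence the metric of the projective space is half of the one
induced by `Φ` (`projectiveMetric_eq_inner`).
By the Koszul formula, the second fundamental form of a map `f` for a metric induced by `Φ` is the
normal component of the second derivative of `Φ ∘ f` (`secondFundamentalForm_eq_inner`).

The preimage `M` is locally the product of `Mbar` and the sphere of unit scalars, by the affine
sections of `Π`; the resulting charts are smooth functions on `Mbar × S` with inverses smooth as
maps to `Mbar × S`, so they define a smooth structure for which `M → Mbar × S` is an immersion
(`isSmoothImmersion_chartedSpaceOfCharts`). Differentiating `Φ ∘ fbar ∘ π = Q ∘ f` once, where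
`π : M → Mbar` and `f : M → S` are the projections, shows that `f` is an immersion and that the
horizontal lift `a` of the normal of `fbar` is a unit normal of `f`. Differentiating it twice, and
taking the component in the direction `dQ a = dΦ Nbar`, gives

  `II_fbar(dπ v, dπ v) = II_f(v, v) + 2 ⟪herm p u, herm a u⟫`, where `u = df v`

(`secondFundamentalForm_proj`). For the trace over an orthonormal frame of `M`, add `p` and `a` to
`df` of the frame to obtain an orthonormal basis of `K^{n+1}`. The last term vanishes on `p` and on
`a`, and its trace over `K^{n+1}` is `dim K * ⟪p, a⟫ = 0`, up to the factor `2`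
(`sum_hermForm_eq_zero`). The trace of the left side is the mean curvature of `fbar`, as `dπ` is an
isometry on horizontal vectors and vanishes on vertical ones; this is obtained from the Parseval
identity, without a frame adapted to the splitting (`sum_embSndDeriv_eq_zero`).
-/

/-! ### Conjugation of the scalars -/

section ScalarConjugation

variable {K : Type*} [NormedDivisionRing K] [InnerProductSpace ℝ K] [HopfScalars K]

/-- Multiplication by `c` scales norms by `‖c‖`, hence inner products by `‖c‖²`. -/
theorem inner_mul_mul_left (c a b : K) : inner ℝ (c * a) (c * b) = ‖c‖ ^ 2 * inner ℝ a b := by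
  rw [real_inner_eq_norm_add_mul_self_sub_norm_mul_self_sub_norm_mul_self_div_two,
    real_inner_eq_norm_add_mul_self_sub_norm_mul_self_sub_norm_mul_self_div_two,
    ← mul_add, norm_mul, norm_mul, norm_mul]
  ring

theorem inner_mul_mul_right (c a b : K) : inner ℝ (a * c) (b * c) = ‖c‖ ^ 2 * inner ℝ a b := by
  rw [real_inner_eq_norm_add_mul_self_sub_norm_mul_self_sub_norm_mul_self_div_two,
    real_inner_eq_norm_add_mul_self_sub_norm_mul_self_sub_norm_mul_self_div_two,
    ← add_mul, norm_mul, norm_mul, norm_mul]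
  ring

/-- The conjugate of a scalar, `‖a‖² a⁻¹`. -/
noncomputable def scalarConj (a : K) : K := (‖a‖ ^ 2 : ℝ) • a⁻¹

theorem scalarConj_mul_self (a : K) : scalarConj a * a = (‖a‖ ^ 2 : ℝ) • (1 : K) := by
  rcases eq_or_ne a 0 with rfl | h
  · simp [scalarConj]
  · rw [scalarConj, smul_mul_assoc, inv_mul_cancel₀ h]

theorem mul_scalarConj_self (a : K) : a * scalarConj a = (‖a‖ ^ 2 : ℝ) • (1 : K) := by
  rcases eq_or_ne a 0 with rfl | h
  · simp [scalarConj]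
  · rw [scalarConj, mul_smul_comm, mul_inv_cancel₀ h]

theorem scalarConj_mul (a b : K) : scalarConj (a * b) = scalarConj b * scalarConj a := by
  rw [scalarConj, scalarConj, scalarConj, mul_inv_rev, smul_mul_assoc, mul_smul_comm, smul_smul,
    norm_mul]
  congr 1
  ring

theorem inner_mul_eq_inner_scalarConj_mul (a b c : K) :
    inner ℝ (a * b) c = inner ℝ b (scalarConj a * c) := by
  rcases eq_or_ne a 0 with rfl | h
  · simp [scalarConj]
  -- Write `c = a (a⁻¹ c)`.
  · conv_lhs => rw [← mul_inv_cancel_left₀ h c]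
    rw [inner_mul_mul_left, scalarConj, smul_mul_assoc, real_inner_smul_right]

theorem inner_mul_eq_inner_mul_scalarConj (a b c : K) :
    inner ℝ (b * a) c = inner ℝ b (c * scalarConj a) := by
  rcases eq_or_ne a 0 with rfl | h
  · simp [scalarConj]
  · conv_lhs => rw [← inv_mul_cancel_right₀ h c]
    rw [mul_assoc, ← mul_assoc c, inner_mul_mul_right, scalarConj, mul_smul_comm,
      real_inner_smul_right]

/-- Conjugation is characterized by `⟨b, conj a⟩ = ⟨a b, 1⟩`; in particular it is linear. -/
theorem inner_scalarConj (a b : K) : inner ℝ b (scalarConj a) = inner ℝ (a * b) (1 : K) := by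
  rw [inner_mul_eq_inner_scalarConj_mul, mul_one]

theorem scalarConj_add (a b : K) : scalarConj (a + b) = scalarConj a + scalarConj b := by
  refine ext_inner_left ℝ fun c => ?_
  rw [inner_add_right, inner_scalarConj, inner_scalarConj, inner_scalarConj, add_mul,
    inner_add_left]

theorem scalarConj_smul (r : ℝ) (a : K) : scalarConj (r • a) = r • scalarConj a := by
  refine ext_inner_left ℝ fun c => ?_
  rw [real_inner_smul_right, inner_scalarConj, inner_scalarConj, smul_mul_assoc,
    real_inner_smul_left]

theorem norm_scalarConj (a : K) : ‖scalarConj a‖ = ‖a‖ := by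
  rcases eq_or_ne a 0 with rfl | h
  · simp [scalarConj]
  · have h' := norm_ne_zero_iff.2 h
    rw [scalarConj, norm_smul, norm_inv, norm_pow, norm_norm]
    field_simp

theorem scalarConj_scalarConj (a : K) : scalarConj (scalarConj a) = a := by
  rcases eq_or_ne a 0 with rfl | h
  · simp [scalarConj]
  · have h' : scalarConj a ≠ 0 := by rwa [← norm_ne_zero_iff, norm_scalarConj, norm_ne_zero_iff]
    refine mul_right_cancel₀ h' ?_
    rw [scalarConj_mul_self, mul_scalarConj_self, norm_scalarConj]

theorem scalarConj_zero : scalarConj (0 : K) = 0 := by simp [scalarConj]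

theorem scalarConj_sum {ι : Type*} (s : Finset ι) (a : ι → K) :
    scalarConj (∑ i ∈ s, a i) = ∑ i ∈ s, scalarConj (a i) := by
  classical
  induction s using Finset.induction_on with
  | empty => simp [scalarConj_zero]
  | insert i s hi ih => rw [Finset.sum_insert hi, Finset.sum_insert hi, scalarConj_add, ih]

/-- The identity `⟨conj(a) b, conj(c) d⟩ = ⟨c conj(a), d conj(b)⟩`. -/
theorem inner_scalarConj_mul_scalarConj_mul (a b c d : K) :
    inner ℝ (scalarConj a * b) (scalarConj c * d)
      = inner ℝ (c * scalarConj a) (d * scalarConj b) := by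
  rw [inner_mul_eq_inner_mul_scalarConj, mul_assoc, ← inner_mul_eq_inner_scalarConj_mul]

end ScalarConjugation

/-! ### Derivatives of quadratic maps -/

section Bilinear

variable {V W : Type*} [NormedAddCommGroup V] [NormedSpace ℝ V] [NormedAddCommGroup W]
  [NormedSpace ℝ W] (B : V →L[ℝ] V →L[ℝ] W)

theorem ContinuousLinearMap.hasFDerivAt_apply_self (p : V) :
    HasFDerivAt (fun q => B q q) (B p + B.flip p) p := by
  have h := B.hasFDerivAt_of_bilinear (hasFDerivAt_id p) (hasFDerivAt_id p)
  refine h.congr_fderiv ?_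
  ext v
  simp

theorem ContinuousLinearMap.contDiff_apply_self {m : ℕ∞ω} : ContDiff ℝ m fun q => B q q :=
  B.contDiff.clm_apply contDiff_id

theorem ContinuousLinearMap.fderiv_fderiv_apply_self (p a b : V) :
    fderiv ℝ (fderiv ℝ fun q => B q q) p a b = B a b + B b a := by
  have h : fderiv ℝ (fun q => B q q) = fun q => (B + B.flip) q := by
    ext1 q
    exact (B.hasFDerivAt_apply_self q).fderiv
  rw [h, ContinuousLinearMap.fderiv]
  rfl

end Bilinear

/-! ### The Hermitian form and the map `p ↦ p* p` -/

section HermitianForm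

variable {K : Type*} [NormedDivisionRing K] [InnerProductSpace ℝ K] [HopfScalars K]
  {ι : Type*} [Fintype ι]

/-- The `K`-valued Hermitian form `∑ aᵢ conj(bᵢ)`, which is `K`-linear in `a`. -/
noncomputable def herm (a b : EuclideanSpace K ι) : K := ∑ i, a i * scalarConj (b i)

theorem herm_add_left (a a' b : EuclideanSpace K ι) :
    herm (a + a') b = herm a b + herm a' b := by
  simp [herm, add_mul, Finset.sum_add_distrib]

theorem herm_add_right (a b b' : EuclideanSpace K ι) :
    herm a (b + b') = herm a b + herm a b' := by
  simp [herm, mul_add, scalarConj_add, Finset.sum_add_distrib]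

theorem herm_smul_left (c : K) (a b : EuclideanSpace K ι) : herm (c • a) b = c * herm a b := by
  simp [herm, mul_assoc, Finset.mul_sum]

theorem herm_real_smul_right (c : ℝ) (a b : EuclideanSpace K ι) :
    herm a (c • b) = c • herm a b := by
  simp only [herm, Finset.smul_sum, PiLp.smul_apply, scalarConj_smul]
  exact Finset.sum_congr rfl fun i _ => mul_smul_comm c (a i) (scalarConj (b i))

theorem scalarConj_herm (a b : EuclideanSpace K ι) : scalarConj (herm a b) = herm b a := by
  simp [herm, scalarConj_sum, scalarConj_mul, scalarConj_scalarConj]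

theorem herm_eq_zero_comm {a b : EuclideanSpace K ι} : herm a b = 0 ↔ herm b a = 0 := by
  constructor <;> intro h <;> rw [← scalarConj_herm, h, scalarConj_zero]

theorem herm_self (a : EuclideanSpace K ι) : herm a a = (‖a‖ ^ 2 : ℝ) • (1 : K) := by
  rw [PiLp.norm_sq_eq_of_L2, Finset.sum_smul]
  exact Finset.sum_congr rfl fun i _ => mul_scalarConj_self (a i)

theorem herm_self_of_norm_eq_one {a : EuclideanSpace K ι} (h : ‖a‖ = 1) : herm a a = 1 := by
  simp [herm_self, h]

/-- Left multiplication by `c` and the Hermitian form: `⟨c a, b⟩ = ⟨c, herm b a⟩`. -/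
theorem inner_smul_eq_inner_herm (c : K) (a b : EuclideanSpace K ι) :
    inner ℝ (c • a) b = inner ℝ c (herm b a) := by
  simp only [PiLp.inner_apply, herm, inner_sum, PiLp.smul_apply, smul_eq_mul,
    inner_mul_eq_inner_mul_scalarConj]

theorem inner_eq_inner_one_herm (a b : EuclideanSpace K ι) :
    inner ℝ a b = inner ℝ (1 : K) (herm b a) := by
  rw [← inner_smul_eq_inner_herm, one_smul]

theorem inner_eq_inner_herm_one (a b : EuclideanSpace K ι) :
    inner ℝ a b = inner ℝ (herm a b) (1 : K) := by
  rw [real_inner_comm, inner_eq_inner_one_herm, real_inner_comm]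

theorem inner_eq_zero_of_herm_eq_zero {a b : EuclideanSpace K ι} (h : herm a b = 0) :
    inner ℝ a b = 0 := by
  rw [inner_eq_inner_herm_one, h, inner_zero_left]

/-- The matrix `a* b` with entries `conj(aᵢ) bⱼ`, as a real bilinear map. -/
noncomputable def starMul :
    EuclideanSpace K ι →L[ℝ] EuclideanSpace K ι →L[ℝ] EuclideanSpace K (ι × ι) :=
  (LinearMap.mk₂ ℝ (fun a b => WithLp.toLp 2 fun k : ι × ι => scalarConj (a k.1) * b k.2)
    (fun a a' b => by ext; simp [scalarConj_add, add_mul])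
    (fun c a b => by
      ext k
      simp only [PiLp.smul_apply, scalarConj_smul]
      exact smul_mul_assoc c (scalarConj (a k.1)) (b k.2))
    (fun a b b' => by ext; simp [mul_add])
    (fun c a b => by
      ext k
      simp only [PiLp.smul_apply]
      exact mul_smul_comm c (scalarConj (a k.1)) (b k.2))).toContinuousBilinearMap

theorem starMul_apply (a b : EuclideanSpace K ι) (k : ι × ι) :
    starMul a b k = scalarConj (a k.1) * b k.2 := rfl

theorem inner_starMul_starMul (a b c d : EuclideanSpace K ι) :
    inner ℝ (starMul a b) (starMul c d) = inner ℝ (herm c a) (herm d b) := by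
  simp only [PiLp.inner_apply, starMul_apply, inner_scalarConj_mul_scalarConj_mul, herm, sum_inner,
    inner_sum, Fintype.sum_prod_type]
  exact Finset.sum_comm

/-- The differential `a ↦ p* a + a* p` of `p ↦ p* p` at `p`. -/
noncomputable def starSqDeriv :
    EuclideanSpace K ι →L[ℝ] EuclideanSpace K ι →L[ℝ] EuclideanSpace K (ι × ι) :=
  starMul + (starMul (K := K) (ι := ι)).flip

theorem starSqDeriv_apply (p a : EuclideanSpace K ι) :
    starSqDeriv p a = starMul p a + starMul a p := rfl

theorem fderiv_starMul_self (p : EuclideanSpace K ι) :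
    fderiv ℝ (fun q : EuclideanSpace K ι => starMul q q) p = starSqDeriv p :=
  ((starMul (K := K) (ι := ι)).hasFDerivAt_apply_self p).fderiv

theorem contDiff_starMul_self {m : ℕ∞ω} :
    ContDiff ℝ m (fun q : EuclideanSpace K ι => starMul q q) :=
  (starMul (K := K) (ι := ι)).contDiff_apply_self

/-- On the vectors horizontal at a unit vector `p`, that is, orthogonal to the line `K p`, the
differential of `p ↦ p* p` is an isometry up to the factor `√2`, and their images are orthogonal to
those of the vectors of this line. -/
theorem inner_starSqDeriv_starSqDeriv {p a : EuclideanSpace K ι} (hp : ‖p‖ = 1)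
    (b : EuclideanSpace K ι) (ha : herm a p = 0) :
    inner ℝ (starSqDeriv p b) (starSqDeriv p a) = 2 * inner ℝ b a := by
  simp only [starSqDeriv_apply, inner_add_left, inner_add_right, inner_starMul_starMul, ha,
    herm_self_of_norm_eq_one hp, inner_zero_left, inner_zero_right]
  rw [← inner_eq_inner_one_herm, ← inner_eq_inner_herm_one, real_inner_comm a b]
  ring

/-- The matrix `p* p` is not changed by a unit scalar. -/
theorem starMul_smul_self {c : K} (hc : ‖c‖ = 1) (p : EuclideanSpace K ι) :
    starMul (c • p) (c • p) = starMul p p := by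
  ext k
  rw [starMul_apply, starMul_apply, PiLp.smul_apply, PiLp.smul_apply, smul_eq_mul, smul_eq_mul,
    scalarConj_mul, mul_assoc, ← mul_assoc (scalarConj c), scalarConj_mul_self, hc]
  simp

/-- The matrix `p* p` determines the orbit of a unit vector `p`. -/
theorem eq_herm_smul_of_starMul_self_eq {p q : EuclideanSpace K ι} (hp : ‖p‖ = 1) (hq : ‖q‖ = 1)
    (h : starMul p p = starMul q q) : ‖herm q p‖ = 1 ∧ q = herm q p • p := by
  have h1 : q = herm q p • p := by
    ext j
    have h2 : ∀ i, scalarConj (p i) * p j = scalarConj (q i) * q j := fun i =>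
      congrArg (fun x : EuclideanSpace K (ι × ι) => x (i, j)) h
    have h3 : herm q q * q j = q j := by rw [herm_self_of_norm_eq_one hq, one_mul]
    rw [PiLp.smul_apply, smul_eq_mul, ← h3]
    simp only [herm, Finset.sum_mul, mul_assoc, h2]
  refine ⟨?_, h1⟩
  have h2 := congrArg norm h1
  rw [norm_smul, hp, hq, mul_one] at h2
  exact h2.symm

/-- For a unit vector `p`, the vector `a - herm a p • p` is the horizontal part of `a`. -/
theorem herm_sub_herm_smul {p : EuclideanSpace K ι} (hp : ‖p‖ = 1) (a : EuclideanSpace K ι) :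
    herm (a - herm a p • p) p = 0 := by
  rw [sub_eq_add_neg, ← neg_smul, herm_add_left, herm_smul_left, herm_self_of_norm_eq_one hp]
  simp

/-- A vector orthogonal to `p` and to all `c p` with `c` orthogonal to the reals is horizontal. -/
theorem herm_eq_zero_of_inner_eq_zero {p a : EuclideanSpace K ι}
    (h0 : inner ℝ a p = 0) (h : ∀ c : K, inner ℝ c (1 : K) = 0 → inner ℝ a (c • p) = 0) :
    herm a p = 0 := by
  have h1 : inner ℝ (herm a p) (1 : K) = 0 := by rw [← inner_eq_inner_herm_one, h0]
  have h2 := h _ h1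
  rwa [real_inner_comm, inner_smul_eq_inner_herm, inner_self_eq_zero] at h2

end HermitianForm

/-! ### Traces of bilinear forms -/

section Trace

variable {V : Type*} [NormedAddCommGroup V] [InnerProductSpace ℝ V]

/-- The trace of a real bilinear form does not depend on the orthonormal basis. -/
theorem OrthonormalBasis.sum_bilin_eq {ι κ : Type*} [Fintype ι] [Fintype κ]
    (b : OrthonormalBasis ι ℝ V) (b' : OrthonormalBasis κ ℝ V) (B : V →ₗ[ℝ] V →ₗ[ℝ] ℝ) :
    ∑ i, B (b i) (b i) = ∑ j, B (b' j) (b' j) := by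
  have h : ∀ i, B (b i) (b i) = ∑ j, ∑ k, inner ℝ (b' j) (b i) * inner ℝ (b i) (b' k) *
      B (b' j) (b' k) := by
    intro i
    conv_lhs => rw [← b'.sum_repr (b i)]
    simp only [map_sum, LinearMap.sum_apply, map_smul, LinearMap.smul_apply, smul_eq_mul,
      b'.repr_apply_apply, Finset.mul_sum]
    rw [Finset.sum_comm]
    refine Finset.sum_congr rfl fun j _ => Finset.sum_congr rfl fun k _ => ?_
    rw [real_inner_comm (b i) (b' k)]
    ring
  classical
  simp only [h]
  rw [Finset.sum_comm]
  refine Finset.sum_congr rfl fun j _ => ?_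
  rw [Finset.sum_comm]
  simp only [← Finset.sum_mul, b.sum_inner_mul_inner, b'.inner_eq_ite]
  simp

end Trace

section TraceHerm

variable {K : Type*} [NormedDivisionRing K] [InnerProductSpace ℝ K] [HopfScalars K]
  {ι : Type*} [Fintype ι]

/-- The real bilinear form `(u, v) ↦ ⟨herm p u, herm a v⟩`. At a point `p` with normal `a`, it is
the difference, up to the factor `2`, of the second fundamental forms of the hypersurface and of its
preimage. -/
noncomputable def hermForm (p a : EuclideanSpace K ι) :
    EuclideanSpace K ι →ₗ[ℝ] EuclideanSpace K ι →ₗ[ℝ] ℝ :=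
  LinearMap.mk₂ ℝ (fun u v => inner ℝ (herm p u) (herm a v))
    (fun u u' v => by rw [herm_add_right, inner_add_left])
    (fun c u v => by rw [herm_real_smul_right, real_inner_smul_left, smul_eq_mul])
    (fun u v v' => by rw [herm_add_right, inner_add_right])
    (fun c u v => by rw [herm_real_smul_right, real_inner_smul_right, smul_eq_mul])

theorem hermForm_apply (p a u v : EuclideanSpace K ι) :
    hermForm p a u v = inner ℝ (herm p u) (herm a v) := rfl

/-- The trace of `hermForm p a` is `dim K * ⟨p, a⟩`; in particular it is zero for `a` orthogonal
to `p`. -/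
theorem sum_hermForm_eq_zero {κ : Type*} [Fintype κ]
    (b : OrthonormalBasis κ ℝ (EuclideanSpace K ι)) {p a : EuclideanSpace K ι}
    (h : inner ℝ p a = 0) : ∑ j, hermForm p a (b j) (b j) = 0 := by
  classical
  rw [b.sum_bilin_eq (Pi.orthonormalBasis fun _ : ι => stdOrthonormalBasis ℝ K)]
  rw [Fintype.sum_sigma]
  have h1 : ∀ (i : ι) (x : EuclideanSpace K ι) (j : Fin (finrank ℝ K)),
      herm x (Pi.orthonormalBasis (fun _ : ι => stdOrthonormalBasis ℝ K) ⟨i, j⟩)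
        = x i * scalarConj (stdOrthonormalBasis ℝ K j) := by
    intro i x j
    rw [herm, Finset.sum_eq_single i]
    · simp
    · intro k _ hk
      simp [hk, scalarConj_zero]
    · simp
  simp only [hermForm_apply, h1, inner_mul_mul_right, norm_scalarConj, OrthonormalBasis.norm_eq_one]
  rw [PiLp.inner_apply] at h
  simp [← Finset.mul_sum, h]

end TraceHerm

/-! ### Second derivatives of compositions -/

section SecondDerivative

variable {E V W : Type*} [NormedAddCommGroup E] [NormedSpace ℝ E] [NormedAddCommGroup V]
  [NormedSpace ℝ V] [NormedAddCommGroup W] [NormedSpace ℝ W]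

theorem ContDiffAt.differentiableAt_fderiv {F : E → V} {p : E} (hF : ContDiffAt ℝ 2 F p) :
    DifferentiableAt ℝ (fderiv ℝ F) p :=
  (hF.fderiv_right (m := 1) (by norm_num)).differentiableAt (by norm_num)

theorem ContDiffAt.fderiv_fderiv_apply {F : E → V} {p : E} (hF : ContDiffAt ℝ 2 F p) (v w : E) :
    fderiv ℝ (fun z => fderiv ℝ F z w) p v = fderiv ℝ (fderiv ℝ F) p v w := by
  rw [fderiv_clm_apply hF.differentiableAt_fderiv (differentiableAt_const w)]
  simp

theorem fderiv_fderiv_comp {G : V → W} {H : E → V} {p : E} (hG : ContDiffAt ℝ 2 G (H p))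
    (hH : ContDiffAt ℝ 2 H p) (v w : E) :
    fderiv ℝ (fderiv ℝ (G ∘ H)) p v w
      = fderiv ℝ (fderiv ℝ G) (H p) (fderiv ℝ H p v) (fderiv ℝ H p w)
        + fderiv ℝ G (H p) (fderiv ℝ (fderiv ℝ H) p v w) := by
  have h1 : fderiv ℝ (G ∘ H) =ᶠ[𝓝 p] fun z => (fderiv ℝ G (H z)).comp (fderiv ℝ H z) := by
    filter_upwards [hH.eventually (by simp), hH.continuousAt.eventually (hG.eventually (by simp))]
      with z h2 h3
    exact fderiv_comp z (h3.differentiableAt (by norm_num)) (h2.differentiableAt (by norm_num))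
  have hH1 : DifferentiableAt ℝ H p := hH.differentiableAt (by norm_num)
  have h4 : DifferentiableAt ℝ (fun z => fderiv ℝ G (H z)) p :=
    hG.differentiableAt_fderiv.comp p hH1
  rw [h1.fderiv_eq, fderiv_clm_comp h4 hH.differentiableAt_fderiv]
  have h5 : fderiv ℝ (fun z => fderiv ℝ G (H z)) p
      = (fderiv ℝ (fderiv ℝ G) (H p)).comp (fderiv ℝ H p) :=
    fderiv_comp p hG.differentiableAt_fderiv hH1
  rw [h5]
  simp [add_comm]

end SecondDerivative

/-! ### The second fundamental form for an induced metric -/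

section InducedMetric

variable {E : Type*} [NormedAddCommGroup E] [NormedSpace ℝ E]
  {N : Type*} [TopologicalSpace N] [ChartedSpace E N] [IsManifold 𝓘(ℝ, E) ∞ N]
  {W : Type*} [NormedAddCommGroup W] [InnerProductSpace ℝ W]

theorem ContMDiff.contDiffAt_comp_extChartAt_symm {E' H' N' V : Type*} [NormedAddCommGroup E']
    [NormedSpace ℝ E'] [TopologicalSpace H'] {I : ModelWithCorners ℝ E' H'} [I.Boundaryless]
    [TopologicalSpace N'] [ChartedSpace H' N']
    [IsManifold I ∞ N'] [NormedAddCommGroup V] [NormedSpace ℝ V] {Φ : N' → V}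
    (hΦ : ContMDiff I 𝓘(ℝ, V) ∞ Φ) (x₀ : N') {z : E'}
    (hz : z ∈ (extChartAt I x₀).target) :
    ContDiffAt ℝ ∞ (Φ ∘ (extChartAt I x₀).symm) z := by
  have h := (hΦ.comp_contMDiffOn (contMDiffOn_extChartAt_symm (I := I) (n := ∞) x₀)).contDiffOn
  exact h.contDiffAt ((isOpen_extChartAt_target x₀).mem_nhds hz)

/-- The differential of a map to a vector space is that of its expression in the preferred
chart. -/
theorem mvfderiv_eq_fderiv_comp_extChartAt_symm {E' H' N' V : Type*} [NormedAddCommGroup E']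
    [NormedSpace ℝ E'] [TopologicalSpace H'] {I : ModelWithCorners ℝ E' H'} [I.Boundaryless]
    [TopologicalSpace N'] [ChartedSpace H' N']
    [NormedAddCommGroup V] [NormedSpace ℝ V] {Φ : N' → V} {y : N'}
    (hΦ : MDifferentiableAt I 𝓘(ℝ, V) Φ y) :
    mvfderiv I Φ y = fderiv ℝ (Φ ∘ (extChartAt I y).symm) (extChartAt I y y) := by
  rw [hΦ.mvfderiv, I.range_eq_univ, fderivWithin_univ]
  rfl

theorem mvfderiv_vector_comp_apply {E₁ H₁ M₁ E₂ H₂ M₂ V : Type*} [NormedAddCommGroup E₁]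
    [NormedSpace ℝ E₁] [TopologicalSpace H₁] {I₁ : ModelWithCorners ℝ E₁ H₁} [TopologicalSpace M₁]
    [ChartedSpace H₁ M₁] [NormedAddCommGroup E₂] [NormedSpace ℝ E₂] [TopologicalSpace H₂]
    {I₂ : ModelWithCorners ℝ E₂ H₂} [TopologicalSpace M₂] [ChartedSpace H₂ M₂]
    [NormedAddCommGroup V] [NormedSpace ℝ V] {Φ : M₂ → V} {f : M₁ → M₂} (x : M₁)
    (hΦ : MDifferentiableAt I₂ 𝓘(ℝ, V) Φ (f x)) (hf : MDifferentiableAt I₁ I₂ f x)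
    (v : TangentSpace I₁ x) :
    mvfderiv I₁ (Φ ∘ f) x v = mvfderiv I₂ Φ (f x) (mfderiv I₁ I₂ f x v) :=
  mfderiv_comp_apply x hΦ hf v

theorem fderiv_comp_extChartAt_symm {Φ : N → W} (hΦ : ContMDiff 𝓘(ℝ, E) 𝓘(ℝ, W) ∞ Φ) (x₀ : N)
    {z : E} (hz : z ∈ (extChartAt 𝓘(ℝ, E) x₀).target) (a : E) :
    fderiv ℝ (Φ ∘ (extChartAt 𝓘(ℝ, E) x₀).symm) z a
      = mvfderiv 𝓘(ℝ, E) Φ ((extChartAt 𝓘(ℝ, E) x₀).symm z)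
        (mfderiv 𝓘(ℝ, E) 𝓘(ℝ, E) (extChartAt 𝓘(ℝ, E) x₀).symm z a) := by
  have h1 : MDifferentiableAt 𝓘(ℝ, E) 𝓘(ℝ, E) (extChartAt 𝓘(ℝ, E) x₀).symm z :=
    (((contMDiffOn_extChartAt_symm (n := ∞) x₀).contMDiffAt
      ((isOpen_extChartAt_target x₀).mem_nhds hz))).mdifferentiableAt (by norm_num)
  have h2 : MDifferentiableAt 𝓘(ℝ, E) 𝓘(ℝ, W) Φ ((extChartAt 𝓘(ℝ, E) x₀).symm z) :=
    hΦ.mdifferentiableAt (by norm_num)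
  rw [← mfderiv_eq_fderiv, mfderiv_comp z h2 h1]
  rfl

variable {g : ∀ y : N, TangentSpace 𝓘(ℝ, E) y → TangentSpace 𝓘(ℝ, E) y → ℝ} {Φ : N → W} {κ : ℝ}

theorem metricInChart_eq_inner_fderiv (hΦ : ContMDiff 𝓘(ℝ, E) 𝓘(ℝ, W) ∞ Φ)
    (hg : ∀ y a b, g y a b = κ * inner ℝ (mvfderiv 𝓘(ℝ, E) Φ y a) (mvfderiv 𝓘(ℝ, E) Φ y b)) (x₀ : N)
    {z : E} (hz : z ∈ (extChartAt 𝓘(ℝ, E) x₀).target) (a b : E) :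
    metricInChart g x₀ z a b = κ * inner ℝ
      (fderiv ℝ (Φ ∘ (extChartAt 𝓘(ℝ, E) x₀).symm) z a)
      (fderiv ℝ (Φ ∘ (extChartAt 𝓘(ℝ, E) x₀).symm) z b) := by
  rw [metricInChart, hg, fderiv_comp_extChartAt_symm hΦ x₀ hz, fderiv_comp_extChartAt_symm hΦ x₀ hz]

theorem fderiv_metricInChart (hΦ : ContMDiff 𝓘(ℝ, E) 𝓘(ℝ, W) ∞ Φ)
    (hg : ∀ y a b, g y a b = κ * inner ℝ (mvfderiv 𝓘(ℝ, E) Φ y a) (mvfderiv 𝓘(ℝ, E) Φ y b)) (x₀ : N)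
    {y : E} (hy : y ∈ (extChartAt 𝓘(ℝ, E) x₀).target) (a b c : E) :
    fderiv ℝ (fun z => metricInChart g x₀ z a b) y c = κ *
      (inner ℝ (fderiv ℝ (fderiv ℝ (Φ ∘ (extChartAt 𝓘(ℝ, E) x₀).symm)) y c a)
        (fderiv ℝ (Φ ∘ (extChartAt 𝓘(ℝ, E) x₀).symm) y b)
      + inner ℝ (fderiv ℝ (Φ ∘ (extChartAt 𝓘(ℝ, E) x₀).symm) y a)
        (fderiv ℝ (fderiv ℝ (Φ ∘ (extChartAt 𝓘(ℝ, E) x₀).symm)) y c b)) := by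
  set φ := Φ ∘ (extChartAt 𝓘(ℝ, E) x₀).symm with hφ
  have h1 : (fun z => metricInChart g x₀ z a b)
      =ᶠ[𝓝 y] fun z => κ * inner ℝ (fderiv ℝ φ z a) (fderiv ℝ φ z b) := by
    filter_upwards [(isOpen_extChartAt_target x₀).mem_nhds hy] with z hz
    exact metricInChart_eq_inner_fderiv hΦ hg x₀ hz a b
  have h2 : ContDiffAt ℝ 2 φ y :=
    (hΦ.contDiffAt_comp_extChartAt_symm x₀ hy).of_le (by norm_cast)
  have h3 : ∀ e : E, DifferentiableAt ℝ (fun z => fderiv ℝ φ z e) y := fun e =>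
    h2.differentiableAt_fderiv.clm_apply (differentiableAt_const e)
  rw [h1.fderiv_eq, fderiv_const_mul ((h3 a).inner ℝ (h3 b))]
  rw [smul_apply, fderiv_inner_apply ℝ (h3 a) (h3 b), h2.fderiv_fderiv_apply,
    h2.fderiv_fderiv_apply, smul_eq_mul, add_comm]

/-- The Koszul formula for the metric induced by a map to a Euclidean space. -/
theorem christoffel_eq_inner (hΦ : ContMDiff 𝓘(ℝ, E) 𝓘(ℝ, W) ∞ Φ)
    (hg : ∀ y a b, g y a b = κ * inner ℝ (mvfderiv 𝓘(ℝ, E) Φ y a) (mvfderiv 𝓘(ℝ, E) Φ y b)) (x₀ : N)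
    {y : E} (hy : y ∈ (extChartAt 𝓘(ℝ, E) x₀).target) (a b c : E) :
    christoffel g x₀ y a b c = κ * inner ℝ
      (fderiv ℝ (fderiv ℝ (Φ ∘ (extChartAt 𝓘(ℝ, E) x₀).symm)) y a b)
      (fderiv ℝ (Φ ∘ (extChartAt 𝓘(ℝ, E) x₀).symm) y c) := by
  rw [christoffel, fderiv_metricInChart hΦ hg x₀ hy, fderiv_metricInChart hΦ hg x₀ hy,
    fderiv_metricInChart hΦ hg x₀ hy]
  set φ := Φ ∘ (extChartAt 𝓘(ℝ, E) x₀).symm with hφ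
  have h2 : ContDiffAt ℝ 2 φ y :=
    (hΦ.contDiffAt_comp_extChartAt_symm x₀ hy).of_le (by norm_cast)
  have hs : IsSymmSndFDerivAt ℝ φ y := h2.isSymmSndFDerivAt (by simp)
  rw [hs.eq b a, hs.eq c a, hs.eq c b, real_inner_comm _ (fderiv ℝ φ y b),
    real_inner_comm _ (fderiv ℝ φ y a)]
  ring

/-- For a metric induced (up to a factor) by a map `Φ` to a Euclidean space, the second
fundamental form of `f` in the direction `ν` is the component of the second derivative of `Φ ∘ f`
in the direction `dΦ ν`. -/
theorem secondFundamentalForm_eq_inner {m : ℕ} {M : Type*} [TopologicalSpace M]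
    [ChartedSpace (EuclideanSpace ℝ (Fin m)) M] [IsManifold (𝓡 m) ∞ M]
    (hΦ : ContMDiff 𝓘(ℝ, E) 𝓘(ℝ, W) ∞ Φ)
    (hg : ∀ y a b, g y a b = κ * inner ℝ (mvfderiv 𝓘(ℝ, E) Φ y a) (mvfderiv 𝓘(ℝ, E) Φ y b))
    {f : M → N} (hf : ContMDiff (𝓡 m) 𝓘(ℝ, E) ∞ f) (x : M) (ν : E)
    (v w : EuclideanSpace ℝ (Fin m)) :
    secondFundamentalForm g f x ν v w = κ * inner ℝ
      (fderiv ℝ (fderiv ℝ ((Φ ∘ f) ∘ (extChartAt (𝓡 m) x).symm)) (extChartAt (𝓡 m) x x) v w)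
      (mvfderiv 𝓘(ℝ, E) Φ (f x) ν) := by
  have hy := mem_extChartAt_target (I := 𝓘(ℝ, E)) (f x)
  simp only [secondFundamentalForm]
  rw [metricInChart_eq_inner_fderiv hΦ hg _ hy, christoffel_eq_inner hΦ hg _ hy, ← mul_add,
    ← inner_add_left,
    mvfderiv_eq_fderiv_comp_extChartAt_symm (hΦ.mdifferentiableAt (by norm_num))]
  set φ := Φ ∘ (extChartAt 𝓘(ℝ, E) (f x)).symm with hφ
  set F := writtenInExtChartAt (𝓡 m) 𝓘(ℝ, E) x f with hF
  have hp := mem_extChartAt_target (I := 𝓡 m) x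
  set p := extChartAt (𝓡 m) x x with hpdef
  have hFp : F p = extChartAt 𝓘(ℝ, E) (f x) (f x) := by simp [hF, hpdef, writtenInExtChartAt]
  have hφ2 : ContDiffAt ℝ 2 φ (F p) := by
    rw [hFp]
    exact (hΦ.contDiffAt_comp_extChartAt_symm (f x) hy).of_le (by norm_cast)
  have hF2 : ContDiffAt ℝ 2 F p := by
    have h := (contMDiffAt_iff.1 (hf x)).2
    rw [(𝓡 m).range_eq_univ, contDiffWithinAt_univ] at h
    exact h.of_le (by norm_cast)
  have hev : (Φ ∘ f) ∘ (extChartAt (𝓡 m) x).symm =ᶠ[𝓝 p] φ ∘ F := by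
    have hc : ContinuousAt (f ∘ (extChartAt (𝓡 m) x).symm) p := by
      refine ContinuousAt.comp ?_ (continuousAt_extChartAt_symm x)
      exact hf.continuous.continuousAt
    have hmem : (extChartAt 𝓘(ℝ, E) (f x)).source ∈ 𝓝 ((f ∘ (extChartAt (𝓡 m) x).symm) p) := by
      rw [Function.comp_apply, hpdef, extChartAt_to_inv]
      exact extChartAt_source_mem_nhds (f x)
    filter_upwards [hc.preimage_mem_nhds hmem] with z hz
    simp only [hφ, hF, writtenInExtChartAt, Function.comp_apply]
    rw [PartialEquiv.left_inv _ hz]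
  rw [hev.fderiv.fderiv_eq, fderiv_fderiv_comp hφ2 hF2, hF2.fderiv_fderiv_apply, hFp, add_comm]
  rfl

end InducedMetric

/-! ### The Hopf projection and the embedding of the projective space -/

section HopfMap

variable {K : Type*} [NormedDivisionRing K] [InnerProductSpace ℝ K] [HopfScalars K] {n : ℕ}

theorem contDiffAt_scalar_inv {a : K} (ha : a ≠ 0) : ContDiffAt ℝ ∞ (fun b : K => b⁻¹) a := by
  let _ := scalarAlgebra K
  have _ : CompleteSpace K := FiniteDimensional.complete ℝ K
  have h := contDiffAt_ringInverse (n := ∞) ℝ (Units.mk0 a ha)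
  rwa [Ring.inverse_eq_inv'] at h

theorem ContDiffAt.scalar_mul {E : Type*} [NormedAddCommGroup E] [NormedSpace ℝ E] {f g : E → K}
    {x : E} (hf : ContDiffAt ℝ ∞ f x) (hg : ContDiffAt ℝ ∞ g x) :
    ContDiffAt ℝ ∞ (fun y => f y * g y) x := by
  let _ := scalarAlgebra K
  exact hf.mul hg

/-- The affine coordinates `(pᵢ⁻¹ pⱼ)_{j ≠ i}` as a map on vectors. -/
def vecAffineCoord (i : Fin (n + 1)) (p : EuclideanSpace K (Fin (n + 1))) : Fin n → K :=
  fun j => (p i)⁻¹ * p (i.succAbove j)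

theorem contDiff_coord (i : Fin (n + 1)) :
    ContDiff ℝ ∞ fun p : EuclideanSpace K (Fin (n + 1)) => p i :=
  contDiff_piLp_apply (𝕜 := ℝ) 2

theorem contDiffAt_vecAffineCoord (i : Fin (n + 1)) {p : EuclideanSpace K (Fin (n + 1))}
    (hp : p i ≠ 0) : ContDiffAt ℝ ∞ (vecAffineCoord i) p := by
  refine contDiffAt_pi.2 fun j => ?_
  exact ((contDiffAt_scalar_inv hp).comp p (contDiff_coord i).contDiffAt).scalar_mul
    (contDiff_coord _).contDiffAt

theorem vecAffineCoord_smul (i : Fin (n + 1)) {c : K} (hc : c ≠ 0)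
    (p : EuclideanSpace K (Fin (n + 1))) : vecAffineCoord i (c • p) = vecAffineCoord i p := by
  ext j
  simp [vecAffineCoord, mul_inv_rev, mul_assoc, hc]

/-- The affine coordinates are constant on the lines `K p`. -/
theorem fderiv_vecAffineCoord_smul (i : Fin (n + 1)) {p : EuclideanSpace K (Fin (n + 1))}
    (hp : p i ≠ 0) (c : K) : fderiv ℝ (vecAffineCoord i) p (c • p) = 0 := by
  have h1 : HasDerivAt (fun t : ℝ => p + t • (c • p)) (c • p) 0 := by
    simpa using ((hasDerivAt_id (0 : ℝ)).smul_const (c • p)).const_add p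
  have h2 : HasFDerivAt (vecAffineCoord i) (fderiv ℝ (vecAffineCoord i) p)
      (p + (0 : ℝ) • (c • p)) := by
    rw [zero_smul, add_zero]
    exact ((contDiffAt_vecAffineCoord i hp).differentiableAt (by norm_num)).hasFDerivAt
  have h3 := h2.comp_hasDerivAt (0 : ℝ) h1
  have h4 : vecAffineCoord i ∘ (fun t : ℝ => p + t • (c • p))
      =ᶠ[𝓝 0] fun _ => vecAffineCoord i p := by
    have hc : ContinuousAt (fun t : ℝ => (1 : K) + t • c) 0 := by fun_prop
    have hne : ∀ᶠ t : ℝ in 𝓝 0, (1 : K) + t • c ≠ 0 := hc.eventually_ne (by simp)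
    filter_upwards [hne] with t ht
    rw [← vecAffineCoord_smul i ht p, add_smul, one_smul, Function.comp_apply]
    congr 2
    ext j
    exact (smul_mul_assoc t c (p j)).symm
  have h5 := h3.congr_of_eventuallyEq h4.symm
  exact h5.unique (hasDerivAt_const _ _)

/-- The index of the affine coordinates used in the preferred chart at `x`. -/
noncomputable def chartIndex (x : KP K n) : Fin (n + 1) := (exists_mem_affineDomain x).choose

theorem mem_affineDomain_chartIndex (x : KP K n) : x ∈ affineDomain (chartIndex x) :=
  (exists_mem_affineDomain x).choose_spec

theorem coord_chartIndex_ne_zero (p : HSphere K n) :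
    (p : EuclideanSpace K (Fin (n + 1))) (chartIndex (hopf p)) ≠ 0 :=
  mem_affineDomain_chartIndex (hopf p)

theorem contMDiff_hopf :
    ContMDiff (𝓡 (sphereDim K n)) 𝓘(ℝ, Fin n → K) ∞ (hopf (K := K) (n := n)) := by
  intro p
  rw [contMDiffAt_iff_target]
  refine ⟨continuous_hopf.continuousAt, ?_⟩
  exact (contDiffAt_vecAffineCoord _ (coord_chartIndex_ne_zero p)).contMDiffAt.comp p
    contMDiff_coe_sphere.contMDiffAt

theorem toAmbient_eq_mvfderiv (p : HSphere K n) (u : TangentSpace (𝓡 (sphereDim K n)) p) :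
    toAmbient p u = mvfderiv (𝓡 (sphereDim K n))
      (fun q : HSphere K n => (q : EuclideanSpace K (Fin (n + 1)))) p u := rfl

theorem mdifferentiable_coe_sphere :
    MDifferentiable (𝓡 (sphereDim K n)) 𝓘(ℝ, EuclideanSpace K (Fin (n + 1)))
      (fun q : HSphere K n => (q : EuclideanSpace K (Fin (n + 1)))) :=
  (contMDiff_coe_sphere (m := 1)).mdifferentiable (by norm_num)

/-- The differential of the projection, in the preferred chart of the projective space, is that of
the affine coordinates. -/
theorem mfderiv_hopf_apply (p : HSphere K n) (u : TangentSpace (𝓡 (sphereDim K n)) p) :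
    mfderiv (𝓡 (sphereDim K n)) 𝓘(ℝ, Fin n → K) hopf p u
      = fderiv ℝ (vecAffineCoord (chartIndex (hopf p))) (p : EuclideanSpace K (Fin (n + 1)))
        (toAmbient p u) := by
  have hd : DifferentiableAt ℝ (vecAffineCoord (chartIndex (hopf p)))
      (p : EuclideanSpace K (Fin (n + 1))) :=
    (contDiffAt_vecAffineCoord _ (coord_chartIndex_ne_zero p)).differentiableAt (by norm_num)
  have h1 := mfderiv_comp p hd.mdifferentiableAt (mdifferentiable_coe_sphere p)
  rw [mfderiv_eq_fderiv] at h1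
  have h2 : mfderiv (𝓡 (sphereDim K n)) 𝓘(ℝ, Fin n → K) hopf p
      = mfderiv (𝓡 (sphereDim K n)) 𝓘(ℝ, Fin n → K) (vecAffineCoord (chartIndex (hopf p)) ∘
        fun q : HSphere K n => (q : EuclideanSpace K (Fin (n + 1)))) p := by
    rw [(contMDiff_hopf.mdifferentiable (by norm_num) p).mfderiv,
      (hd.mdifferentiableAt.comp p (mdifferentiable_coe_sphere p)).mfderiv]
    rfl
  rw [h2, h1]
  rfl

theorem norm_coe_hSphere (p : HSphere K n) : ‖(p : EuclideanSpace K (Fin (n + 1)))‖ = 1 :=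
  norm_eq_of_mem_sphere p

theorem inner_toAmbient_self (p : HSphere K n) (u : TangentSpace (𝓡 (sphereDim K n)) p) :
    inner ℝ (toAmbient p u) (p : EuclideanSpace K (Fin (n + 1))) = 0 := by
  have h : toAmbient p u ∈ (ℝ ∙ (p : EuclideanSpace K (Fin (n + 1))))ᗮ := by
    rw [← range_mvfderiv_subtypeVal (n := sphereDim K n) p]
    exact ⟨u, rfl⟩
  rw [real_inner_comm]
  exact Submodule.mem_orthogonal_singleton_iff_inner_right.1 h

theorem exists_toAmbient_eq (p : HSphere K n) {a : EuclideanSpace K (Fin (n + 1))}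
    (h : inner ℝ a (p : EuclideanSpace K (Fin (n + 1))) = 0) :
    ∃ u : TangentSpace (𝓡 (sphereDim K n)) p, toAmbient p u = a := by
  have h' : a ∈ (ℝ ∙ (p : EuclideanSpace K (Fin (n + 1))))ᗮ := by
    rw [Submodule.mem_orthogonal_singleton_iff_inner_right, real_inner_comm, h]
  rw [← range_mvfderiv_subtypeVal (n := sphereDim K n) p] at h'
  exact h'

/-- The isometric embedding (up to the factor `√2`) `[p] ↦ p* p` of the projective space in the
matrices. -/
noncomputable def kpStarSq : KP K n → EuclideanSpace K (Fin (n + 1) × Fin (n + 1)) :=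
  Quotient.lift (s := orbitSetoid K n)
    (fun p => starMul (p : EuclideanSpace K (Fin (n + 1))) (p : EuclideanSpace K (Fin (n + 1)))) (by
      rintro p q ⟨c, hc, h⟩
      simp only [h, starMul_smul_self hc])

theorem contDiff_affineVec (i : Fin (n + 1)) : ContDiff ℝ ∞ (affineVec (K := K) i) := by
  refine contDiff_piLp' 2 fun k => ?_
  rcases Fin.eq_self_or_eq_succAbove i k with rfl | ⟨l, rfl⟩
  · simpa using contDiff_const
  · simpa using contDiff_apply ℝ K l

theorem contDiff_affineSection (i : Fin (n + 1)) : ContDiff ℝ ∞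
    fun z : Fin n → K => (affineSection i z : EuclideanSpace K (Fin (n + 1))) :=
  ((contDiff_affineVec i).norm ℝ (affineVec_ne_zero i)).inv
    (fun z => norm_ne_zero_iff.2 (affineVec_ne_zero i z)) |>.smul (contDiff_affineVec i)

theorem contMDiff_kpStarSq : ContMDiff 𝓘(ℝ, Fin n → K)
    𝓘(ℝ, EuclideanSpace K (Fin (n + 1) × Fin (n + 1))) ∞ (kpStarSq (K := K) (n := n)) := by
  intro x
  rw [contMDiffAt_iff_source]
  refine ContMDiff.contMDiffAt ?_ |>.contMDiffWithinAt
  exact (contDiff_starMul_self.comp (contDiff_affineSection (chartIndex x))).contMDiff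

theorem kpStarSq_injective : Function.Injective (kpStarSq (K := K) (n := n)) := by
  intro x y h
  obtain ⟨p, rfl⟩ := hopf_surjective x
  obtain ⟨q, rfl⟩ := hopf_surjective y
  rw [hopf_eq_iff]
  exact ⟨_, eq_herm_smul_of_starMul_self_eq (norm_coe_hSphere p) (norm_coe_hSphere q) h⟩

instance : T2Space (KP K n) :=
  T2Space.of_injective_continuous kpStarSq_injective contMDiff_kpStarSq.continuous

/-- The differential of the identity `Φ ∘ Π = Q` on the sphere, with `Φ = kpStarSq` and
`Q p = p* p`. -/
theorem mvfderiv_kpStarSq_mfderiv_hopf (p : HSphere K n)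
    (u : TangentSpace (𝓡 (sphereDim K n)) p) :
    mvfderiv 𝓘(ℝ, Fin n → K) kpStarSq (hopf p)
      (mfderiv (𝓡 (sphereDim K n)) 𝓘(ℝ, Fin n → K) hopf p u)
      = starSqDeriv (p : EuclideanSpace K (Fin (n + 1))) (toAmbient p u) := by
  have h0 := mvfderiv_vector_comp_apply p (contMDiff_kpStarSq.mdifferentiable (by norm_num) _)
    (contMDiff_hopf.mdifferentiable (by norm_num) p) u
  rw [← fderiv_starMul_self]
  refine h0.symm.trans ?_
  have hd : DifferentiableAt ℝ (fun q : EuclideanSpace K (Fin (n + 1)) => starMul q q)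
    (p : EuclideanSpace K (Fin (n + 1))) := contDiff_starMul_self.differentiable one_ne_zero _
  have h1 := mvfderiv_vector_comp_apply p hd.mdifferentiableAt (mdifferentiable_coe_sphere p) u
  rw [← mfderiv_eq_fderiv]
  exact h1

/-- The tangent vectors in the line `K p` are vertical. -/
theorem mfderiv_hopf_eq_zero {p : HSphere K n} {u : TangentSpace (𝓡 (sphereDim K n)) p} {c : K}
    (h : toAmbient p u = c • (p : EuclideanSpace K (Fin (n + 1)))) :
    mfderiv (𝓡 (sphereDim K n)) 𝓘(ℝ, Fin n → K) hopf p u = 0 := by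
  rw [mfderiv_hopf_apply, h]
  exact fderiv_vecAffineCoord_smul _ (coord_chartIndex_ne_zero p) c

/-- Horizontality in terms of the Hermitian form: the fiber through `p` is the unit sphere of the
line `K p`. -/
theorem isHorizontalLift_iff (p : HSphere K n) (v : TangentSpace 𝓘(ℝ, Fin n → K) (hopf p))
    (u : TangentSpace (𝓡 (sphereDim K n)) p) : IsHorizontalLift p v u ↔
      mfderiv (𝓡 (sphereDim K n)) 𝓘(ℝ, Fin n → K) hopf p u = v ∧
        herm (toAmbient p u) (p : EuclideanSpace K (Fin (n + 1))) = 0 := by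
  refine and_congr_right fun _ => ⟨fun h => ?_, fun h w hw => ?_⟩
  · refine herm_eq_zero_of_inner_eq_zero (inner_toAmbient_self p u) fun c hc => ?_
    obtain ⟨w, hw⟩ := exists_toAmbient_eq p
      (a := c • (p : EuclideanSpace K (Fin (n + 1)))) (by
        rw [inner_smul_eq_inner_herm, herm_self_of_norm_eq_one (norm_coe_hSphere p), hc])
    rw [← hw]
    exact h w (mfderiv_hopf_eq_zero hw)
  · have h1 := inner_starSqDeriv_starSqDeriv (norm_coe_hSphere p) (toAmbient p w) h
    rw [← mvfderiv_kpStarSq_mfderiv_hopf p w, hw, map_zero, inner_zero_left] at h1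
    rw [sphereMetric, real_inner_comm]
    linarith

/-- Existence of horizontal lifts: lift by a section of the affine coordinates, and take the
horizontal part. -/
theorem exists_isHorizontalLift (p : HSphere K n) (v : TangentSpace 𝓘(ℝ, Fin n → K) (hopf p)) :
    ∃ u, IsHorizontalLift p v u := by
  set i := chartIndex (hopf p) with hi
  have hp := coord_chartIndex_ne_zero p
  rw [← hi] at hp
  set P : EuclideanSpace K (Fin (n + 1)) := (p : EuclideanSpace K (Fin (n + 1))) with hP
  -- The section `z ↦ pᵢ (1, z)` of the affine coordinates passes through `p`.
  let σ : (Fin n → K) → EuclideanSpace K (Fin (n + 1)) := fun z => P i • affineVec i z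
  have hσ : ContDiff ℝ ∞ σ := by
    refine contDiff_piLp' 2 fun k => ?_
    refine contDiff_iff_contDiffAt.2 fun z => ?_
    exact contDiffAt_const.scalar_mul ((contDiff_coord k).comp (contDiff_affineVec i)).contDiffAt
  have hAσ : ∀ z, vecAffineCoord i (σ z) = z := by
    intro z
    rw [vecAffineCoord_smul i hp]
    ext j
    simp [vecAffineCoord]
  have hσp : σ (vecAffineCoord i P) = P := by
    ext j
    rcases Fin.eq_self_or_eq_succAbove i j with h | ⟨k, rfl⟩
    · simp [σ, h]
    · simp [σ, vecAffineCoord, hp]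
  set a := fderiv ℝ σ (vecAffineCoord i P) v with ha
  have hd : DifferentiableAt ℝ (vecAffineCoord i) P :=
    (contDiffAt_vecAffineCoord i hp).differentiableAt (by norm_num)
  have hAa : fderiv ℝ (vecAffineCoord i) P a = v := by
    have h1 : fderiv ℝ (vecAffineCoord i ∘ σ) (vecAffineCoord i P) = .id ℝ _ := by
      have h2 : vecAffineCoord i ∘ σ = id := funext hAσ
      rw [h2, fderiv_id]
    rw [fderiv_comp _ (by rw [hσp]; exact hd) (hσ.differentiable (by norm_num) _), hσp] at h1
    exact congrArg (fun L : (Fin n → K) →L[ℝ] (Fin n → K) => L v) h1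
  have hh := herm_sub_herm_smul (norm_coe_hSphere p) a
  obtain ⟨u, hu⟩ := exists_toAmbient_eq p (inner_eq_zero_of_herm_eq_zero hh)
  refine ⟨u, (isHorizontalLift_iff p v u).2 ⟨?_, by rw [hu, hh]⟩⟩
  rw [mfderiv_hopf_apply, hu, map_sub, ← hi, ← hP, hAa, fderiv_vecAffineCoord_smul i hp]
  exact sub_zero (G := Fin n → K) v

theorem isHorizontalLift_horizontalLift (p : HSphere K n)
    (v : TangentSpace 𝓘(ℝ, Fin n → K) (hopf p)) : IsHorizontalLift p v (horizontalLift p v) :=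
  Classical.epsilon_spec (exists_isHorizontalLift p v)

theorem mfderiv_hopf_horizontalLift (p : HSphere K n)
    (v : TangentSpace 𝓘(ℝ, Fin n → K) (hopf p)) :
    mfderiv (𝓡 (sphereDim K n)) 𝓘(ℝ, Fin n → K) hopf p (horizontalLift p v) = v :=
  (isHorizontalLift_horizontalLift p v).1

theorem herm_horizontalLift (p : HSphere K n) (v : TangentSpace 𝓘(ℝ, Fin n → K) (hopf p)) :
    herm (toAmbient p (horizontalLift p v)) (p : EuclideanSpace K (Fin (n + 1))) = 0 :=
  ((isHorizontalLift_iff p v _).1 (isHorizontalLift_horizontalLift p v)).2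

theorem mvfderiv_kpStarSq_eq_starSqDeriv (p : HSphere K n)
    (v : TangentSpace 𝓘(ℝ, Fin n → K) (hopf p)) :
    mvfderiv 𝓘(ℝ, Fin n → K) kpStarSq (hopf p) v
      = starSqDeriv (p : EuclideanSpace K (Fin (n + 1))) (toAmbient p (horizontalLift p v)) := by
  rw [← mvfderiv_kpStarSq_mfderiv_hopf, mfderiv_hopf_horizontalLift]

theorem inner_mvfderiv_kpStarSq (p : HSphere K n)
    (v w : TangentSpace 𝓘(ℝ, Fin n → K) (hopf p)) :
    inner ℝ (mvfderiv 𝓘(ℝ, Fin n → K) kpStarSq (hopf p) v)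
      (mvfderiv 𝓘(ℝ, Fin n → K) kpStarSq (hopf p) w)
      = 2 * sphereMetric p (horizontalLift p v) (horizontalLift p w) := by
  rw [mvfderiv_kpStarSq_eq_starSqDeriv, mvfderiv_kpStarSq_eq_starSqDeriv,
    inner_starSqDeriv_starSqDeriv (norm_coe_hSphere p) _ (herm_horizontalLift p w), sphereMetric]

/-- The metric of the projective space is induced, up to the factor `2`, by `kpStarSq`. -/
theorem projectiveMetric_eq_inner (x : KP K n) (v w : TangentSpace 𝓘(ℝ, Fin n → K) x) :
    projectiveMetric x v w = 1 / 2 * inner ℝ (mvfderiv 𝓘(ℝ, Fin n → K) kpStarSq x v)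
      (mvfderiv 𝓘(ℝ, Fin n → K) kpStarSq x w) := by
  have h : ∀ y : KP K n, y = x → ∀ v : Fin n → K,
      mvfderiv 𝓘(ℝ, Fin n → K) kpStarSq y v = mvfderiv 𝓘(ℝ, Fin n → K) kpStarSq x v := by
    rintro _ rfl v
    rfl
  have hx : hopf (Quotient.out x : HSphere K n) = x := Quotient.out_eq x
  have h1 := inner_mvfderiv_kpStarSq (Quotient.out x : HSphere K n) v w
  -- The points `hopf (Quotient.out x)` and `x` are equal, but not by definition.
  erw [h _ hx v, h _ hx w] at h1
  erw [h1]
  rw [projectiveMetric]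
  ring

theorem mvfderiv_kpStarSq_injective (x : KP K n) :
    Function.Injective (mvfderiv 𝓘(ℝ, Fin n → K) (kpStarSq (K := K) (n := n)) x) := by
  obtain ⟨p, rfl⟩ := hopf_surjective x
  refine (injective_iff_map_eq_zero _).2 fun v hv => ?_
  have h := inner_mvfderiv_kpStarSq p v v
  rw [hv, inner_zero_left, sphereMetric] at h
  have h1 : toAmbient p (horizontalLift p v) = 0 :=
    inner_self_eq_zero (𝕜 := ℝ).1 (by linarith)
  rw [← mfderiv_hopf_horizontalLift p v]
  exact mfderiv_hopf_eq_zero (c := 0) (by rw [h1, zero_smul])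

theorem sphereMetric_eq_inner (p : HSphere K n) (v w : TangentSpace (𝓡 (sphereDim K n)) p) :
    sphereMetric p v w = 1 * inner ℝ
      (mvfderiv (𝓡 (sphereDim K n))
        (fun q : HSphere K n => (q : EuclideanSpace K (Fin (n + 1)))) p v)
      (mvfderiv (𝓡 (sphereDim K n))
        (fun q : HSphere K n => (q : EuclideanSpace K (Fin (n + 1)))) p w) := by
  rw [one_mul]
  rfl

end HopfMap

/-! ### Manifold structures given by charts -/

section InducedStructure

variable {E : Type*} [NormedAddCommGroup E] [NormedSpace ℝ E]
  {M : Type*} [TopologicalSpace M] {ι : Type*}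

/-- The charted space structure with the given charts, the preferred one at `q` having the index
`idx q`. -/
@[reducible] noncomputable def chartedSpaceOfCharts (φ : ι → OpenPartialHomeomorph M E)
    (idx : M → ι) (h : ∀ q, q ∈ (φ (idx q)).source) : ChartedSpace E M where
  atlas := range φ
  chartAt q := φ (idx q)
  mem_chart_source := h
  chart_mem_atlas _ := mem_range_self _

variable {E' H' P : Type*} [NormedAddCommGroup E'] [NormedSpace ℝ E'] [TopologicalSpace H']
  {J : ModelWithCorners ℝ E' H'} [TopologicalSpace P] [ChartedSpace H' P]

variable {φ : ι → OpenPartialHomeomorph M E} {j : M → P} {r : ι → P → E}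

/-- Charts that are restrictions of smooth functions on `P`, and whose inverses are smooth as maps
to `P`, are compatible. -/
theorem isManifold_chartedSpaceOfCharts (idx : M → ι) (h : ∀ q, q ∈ (φ (idx q)).source)
    (hj : ∀ a, ContMDiffOn 𝓘(ℝ, E) J ∞ (j ∘ (φ a).symm) (φ a).target)
    (hr : ∀ a, ∀ q ∈ (φ a).source, ContMDiffAt J 𝓘(ℝ, E) ∞ (r a) (j q))
    (hφ : ∀ a, ∀ q ∈ (φ a).source, φ a q = r a (j q)) :
    @IsManifold ℝ _ E _ _ E _ 𝓘(ℝ, E) ∞ M _ (chartedSpaceOfCharts φ idx h) := by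
  let _ := chartedSpaceOfCharts φ idx h
  refine isManifold_of_contDiffOn _ _ _ ?_
  rintro _ _ ⟨a, rfl⟩ ⟨b, rfl⟩
  have hs : ∀ z ∈ ((φ a).symm.trans (φ b)).source,
      z ∈ (φ a).target ∧ (φ a).symm z ∈ (φ b).source := fun z hz => by simpa using hz
  have key : ContDiffOn ℝ ∞ (r b ∘ j ∘ (φ a).symm) ((φ a).symm.trans (φ b)).source := by
    rw [← contMDiffOn_iff_contDiffOn]
    intro z hz
    have h1 := (hj a).contMDiffAt ((φ a).open_target.mem_nhds (hs z hz).1)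
    exact ((hr b _ (hs z hz).2).comp z h1).contMDiffWithinAt
  refine key.congr_mono ?_ fun z hz => by simpa using hz
  intro z hz
  have hz' : z ∈ ((φ a).symm.trans (φ b)).source := by simpa using hz
  exact hφ b _ (hs z hz').2

/-- In the situation of `isManifold_chartedSpaceOfCharts`, the map of `M` to `P` is an immersion. -/
theorem isSmoothImmersion_chartedSpaceOfCharts [IsManifold J ∞ P] (idx : M → ι)
    (h : ∀ q, q ∈ (φ (idx q)).source)
    (hj : ∀ a, ContMDiffOn 𝓘(ℝ, E) J ∞ (j ∘ (φ a).symm) (φ a).target)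
    (hr : ∀ a, ∀ q ∈ (φ a).source, ContMDiffAt J 𝓘(ℝ, E) ∞ (r a) (j q))
    (hφ : ∀ a, ∀ q ∈ (φ a).source, φ a q = r a (j q)) :
    @IsSmoothImmersion E E M E' H' P _ _ _ 𝓘(ℝ, E) _ (chartedSpaceOfCharts φ idx h) _ _ _ J _ _
      j := by
  let _ := chartedSpaceOfCharts φ idx h
  have := isManifold_chartedSpaceOfCharts idx h hj hr hφ
  have hsmooth : ContMDiff 𝓘(ℝ, E) J ∞ j := by
    intro q
    rw [contMDiffAt_iff_source]
    refine ContMDiffAt.contMDiffWithinAt ?_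
    refine (hj (idx q)).contMDiffAt ((φ (idx q)).open_target.mem_nhds ?_)
    exact (φ (idx q)).map_source (h q)
  refine ⟨hsmooth, fun q => ?_⟩
  have hrq : MDifferentiableAt J 𝓘(ℝ, E) (r (idx q)) (j q) :=
    (hr (idx q) q (h q)).mdifferentiableAt (by norm_num)
  have hjq : MDifferentiableAt 𝓘(ℝ, E) J j q := hsmooth.mdifferentiableAt (by norm_num)
  have h1 : mvfderiv 𝓘(ℝ, E) (r (idx q) ∘ j) q = ContinuousLinearMap.id ℝ E := by
    rw [mvfderiv_eq_fderiv_comp_extChartAt_symm (hrq.comp q hjq)]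
    have h2 : (r (idx q) ∘ j) ∘ (extChartAt 𝓘(ℝ, E) q).symm
        =ᶠ[𝓝 (extChartAt 𝓘(ℝ, E) q q)] id := by
      filter_upwards [extChartAt_target_mem_nhds (I := 𝓘(ℝ, E)) q] with z hz
      have hz' : z ∈ (φ (idx q)).target := by
        have hz1 : z ∈ (chartAt E q).target := by simpa using hz
        exact hz1
      change r (idx q) (j ((φ (idx q)).symm z)) = z
      rw [← hφ _ _ ((φ (idx q)).map_target hz'), (φ (idx q)).right_inv hz']
    rw [h2.fderiv_eq, fderiv_id]
  intro v w hvw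
  have h3 : ∀ u : TangentSpace 𝓘(ℝ, E) q,
      mvfderiv J (r (idx q)) (j q) (mfderiv 𝓘(ℝ, E) J j q u) = u := by
    intro u
    rw [← mvfderiv_vector_comp_apply q hrq hjq, h1]
    rfl
  have h4 := h3 v
  rw [hvw] at h4
  exact h4.symm.trans (h3 w)

end InducedStructure

/-! ### The radial projection to the sphere -/

section SphereNormalize

variable {V : Type*} [NormedAddCommGroup V] [InnerProductSpace ℝ V] {k : ℕ}
  [Fact (finrank ℝ V = k + 1)]

/-- The radial projection `v ↦ v / ‖v‖` to the unit sphere, with the value `v₀` at zero. -/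
noncomputable def sphereNormalize (v₀ : sphere (0 : V) 1) (v : V) : sphere (0 : V) 1 :=
  open Classical in
  if h : v = 0 then v₀ else ⟨‖v‖⁻¹ • v, by simp [norm_smul, h]⟩

theorem coe_sphereNormalize (v₀ : sphere (0 : V) 1) {v : V} (h : v ≠ 0) :
    (sphereNormalize v₀ v : V) = ‖v‖⁻¹ • v := by
  rw [sphereNormalize, dif_neg h]

theorem sphereNormalize_coe (v₀ v : sphere (0 : V) 1) : sphereNormalize v₀ (v : V) = v := by
  ext
  rw [coe_sphereNormalize _ (ne_zero_of_mem_unit_sphere v), norm_eq_of_mem_sphere v]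
  simp

theorem sphereNormalize_smul (v₀ v : sphere (0 : V) 1) {t : ℝ} (ht : 0 < t) :
    sphereNormalize v₀ (t • (v : V)) = v := by
  ext
  rw [coe_sphereNormalize _ (smul_ne_zero ht.ne' (ne_zero_of_mem_unit_sphere v)), norm_smul,
    norm_eq_of_mem_sphere v, mul_one, Real.norm_of_nonneg ht.le, smul_smul,
    inv_mul_cancel₀ ht.ne', one_smul]

theorem contMDiffAt_sphereNormalize (v₀ : sphere (0 : V) 1) {v : V} (hv : v ≠ 0) :
    ContMDiffAt 𝓘(ℝ, V) (𝓡 k) ∞ (sphereNormalize v₀) v := by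
  have hn : ContDiffAt ℝ ∞ (fun w : V => ‖w‖⁻¹ • w) v :=
    ((contDiffAt_norm ℝ hv).inv (norm_ne_zero_iff.2 hv)).smul contDiffAt_id
  have hev : (fun w => (sphereNormalize v₀ w : V)) =ᶠ[𝓝 v] fun w => ‖w‖⁻¹ • w := by
    filter_upwards [isOpen_ne.mem_nhds hv] with w hw using coe_sphereNormalize v₀ hw
  have hs := hn.congr_of_eventuallyEq hev
  set c := sphereNormalize v₀ v with hc
  rw [contMDiffAt_iff_target]
  refine ⟨IsInducing.subtypeVal.continuousAt_iff.2 hs.continuousAt, ?_⟩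
  · let U : _ ≃ₗᵢ[ℝ] _ := (OrthonormalBasis.fromOrthogonalSpanSingleton (𝕜 := ℝ)
        k (ne_zero_of_mem_unit_sphere (-c))).repr
    have h1 : ContDiffAt ℝ ∞ (stereoToFun (-c : V)) (c : V) := by
      refine (contDiffOn_stereoToFun (n := ∞)).contDiffAt ?_
      refine IsOpen.mem_nhds ?_ ?_
      · exact isOpen_ne_fun (innerSL ℝ (-c : V)).continuous continuous_const
      · change innerSL ℝ (-c : V) (c : V) ≠ 1
        rw [innerSL_apply_apply, inner_neg_left, real_inner_self_eq_norm_sq,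
          norm_eq_of_mem_sphere c]
        norm_num
    exact (U.contDiff.contDiffAt.comp v (h1.comp v hs)).contMDiffAt

theorem contMDiffAt_sphere_of_coe {E' H' P : Type*} [NormedAddCommGroup E'] [NormedSpace ℝ E']
    [TopologicalSpace H'] {J : ModelWithCorners ℝ E' H'} [TopologicalSpace P] [ChartedSpace H' P]
    {f : P → sphere (0 : V) 1} {x : P}
    (hf : ContMDiffAt J 𝓘(ℝ, V) ∞ (fun y => (f y : V)) x) : ContMDiffAt J (𝓡 k) ∞ f x := by
  have h := (contMDiffAt_sphereNormalize (k := k) (f x) (ne_zero_of_mem_unit_sphere (f x))).comp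
    x hf
  refine h.congr_of_eventuallyEq (Filter.Eventually.of_forall fun y => ?_)
  exact (sphereNormalize_coe _ _).symm

end SphereNormalize

/-! ### Charts of the preimage -/

section OrbitCharts

variable {K : Type*} [NormedDivisionRing K] [InnerProductSpace ℝ K] [HopfScalars K] {n : ℕ}

instance : Fact (finrank ℝ K = finrank ℝ K - 1 + 1) :=
  ⟨(Nat.sub_add_cancel finrank_pos).symm⟩

/-- The unit scalar `pᵢ / ‖pᵢ‖`, with the value `1` where `pᵢ = 0`. -/
noncomputable def unitCoord (i : Fin (n + 1)) (p : HSphere K n) : sphere (0 : K) 1 :=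
  sphereNormalize ⟨1, by simp⟩ ((p : EuclideanSpace K (Fin (n + 1))) i)

theorem unit_smul_mem_sphere (c : sphere (0 : K) 1) (p : HSphere K n) :
    (c : K) • (p : EuclideanSpace K (Fin (n + 1)))
      ∈ sphere (0 : EuclideanSpace K (Fin (n + 1))) 1 := by
  rw [mem_sphere_zero_iff_norm, norm_smul, norm_eq_of_mem_sphere c, norm_eq_of_mem_sphere p,
    one_mul]

/-- The action of the unit scalars on the sphere. -/
def unitSmul (c : sphere (0 : K) 1) (p : HSphere K n) : HSphere K n :=
  ⟨(c : K) • (p : EuclideanSpace K (Fin (n + 1))), unit_smul_mem_sphere c p⟩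

theorem hopf_unitSmul (c : sphere (0 : K) 1) (p : HSphere K n) :
    hopf (unitSmul c p) = hopf p :=
  ((hopf_eq_iff p _).2 ⟨c, norm_eq_of_mem_sphere c, rfl⟩).symm

theorem unitCoord_unitSmul_affineSection (i : Fin (n + 1)) (c : sphere (0 : K) 1)
    (z : Fin n → K) : unitCoord i (unitSmul c (affineSection i z)) = c := by
  have h : (unitSmul c (affineSection i z) : EuclideanSpace K (Fin (n + 1))) i
      = ‖affineVec i z‖⁻¹ • (c : K) := by
    change (c : K) * (affineSection i z : EuclideanSpace K (Fin (n + 1))) i = _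
    rw [affineSection_apply, affineVec_same, mul_smul_comm, mul_one]
  rw [unitCoord, h]
  exact sphereNormalize_smul _ _ (inv_pos.2 (norm_pos_iff.2 (affineVec_ne_zero i z)))

theorem unitSmul_unitCoord_affineSection (i : Fin (n + 1)) {p : HSphere K n}
    (hp : (p : EuclideanSpace K (Fin (n + 1))) i ≠ 0) :
    unitSmul (unitCoord i p) (affineSection i (affineCoord i (hopf p))) = p := by
  obtain ⟨c, hc, h⟩ := (hopf_eq_iff _ _).1 (hopf_affineSection i p hp)
  have h1 : p = unitSmul ⟨c, by simpa using hc⟩ (affineSection i (affineCoord i (hopf p))) :=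
    Subtype.ext h
  have h2 : unitCoord i p = ⟨c, by simpa using hc⟩ := by
    conv_lhs => rw [h1]
    exact unitCoord_unitSmul_affineSection i _ _
  rw [h2]
  exact h1.symm

theorem contMDiffAt_unitCoord (i : Fin (n + 1)) {p : HSphere K n}
    (hp : (p : EuclideanSpace K (Fin (n + 1))) i ≠ 0) :
    ContMDiffAt (𝓡 (sphereDim K n)) (𝓡 (finrank ℝ K - 1)) ∞ (unitCoord i) p := by
  have h1 : ContMDiffAt (𝓡 (sphereDim K n)) 𝓘(ℝ, K) ∞
      (fun q : HSphere K n => (q : EuclideanSpace K (Fin (n + 1))) i) p :=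
    (contDiff_coord i).contMDiff.contMDiffAt.comp p contMDiff_coe_sphere.contMDiffAt
  exact (contMDiffAt_sphereNormalize _ hp).comp p h1

theorem contDiff_scalar_smul :
    ContDiff ℝ ∞ fun x : K × EuclideanSpace K (Fin (n + 1)) => x.1 • x.2 := by
  refine contDiff_piLp' 2 fun k => contDiff_iff_contDiffAt.2 fun x => ?_
  exact contDiffAt_fst.scalar_mul ((contDiff_coord k).comp contDiff_snd).contDiffAt

theorem contMDiff_unitSmul_affineSection (i : Fin (n + 1)) :
    ContMDiff ((𝓡 (finrank ℝ K - 1)).prod 𝓘(ℝ, Fin n → K)) (𝓡 (sphereDim K n)) ∞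
      fun x : sphere (0 : K) 1 × (Fin n → K) => unitSmul x.1 (affineSection i x.2) := by
  intro x
  refine contMDiffAt_sphere_of_coe ?_
  have h1 : ContMDiff ((𝓡 (finrank ℝ K - 1)).prod 𝓘(ℝ, Fin n → K)) 𝓘(ℝ, K) ∞
      fun x : sphere (0 : K) 1 × (Fin n → K) => (x.1 : K) :=
    contMDiff_coe_sphere.comp contMDiff_fst
  have h2 : ContMDiff ((𝓡 (finrank ℝ K - 1)).prod 𝓘(ℝ, Fin n → K))
      𝓘(ℝ, EuclideanSpace K (Fin (n + 1))) ∞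
      fun x : sphere (0 : K) 1 × (Fin n → K) =>
        (affineSection i x.2 : EuclideanSpace K (Fin (n + 1))) :=
    (contDiff_affineSection i).contMDiff.comp contMDiff_snd
  exact contDiff_scalar_smul.contMDiff.contMDiffAt.comp x (h1.prodMk_space h2).contMDiffAt

variable {Mbar : Type*} [TopologicalSpace Mbar] {fbar : Mbar → KP K n}

/-- The lift to the sphere of the point `fbar x`, where `x = y.1`, with `i`-th coordinate a
positive multiple of the unit scalar `y.2`. -/
noncomputable def orbitLift (fbar : Mbar → KP K n) (i : Fin (n + 1))
    (y : Mbar × sphere (0 : K) 1) : HSphere K n :=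
  unitSmul y.2 (affineSection i (affineCoord i (fbar y.1)))

theorem hopf_orbitLift (i : Fin (n + 1)) (y : Mbar × sphere (0 : K) 1)
    (hy : fbar y.1 ∈ affineDomain i) : hopf (orbitLift fbar i y) = fbar y.1 := by
  rw [orbitLift, hopf_unitSmul]
  exact (affineChart i).left_inv hy

/-- The point of the preimage of `fbar` over `y.1` given by `orbitLift`. It takes arbitrary values
where the `i`-th homogeneous coordinate of `fbar y.1` vanishes. -/
noncomputable def preimageLift (fbar : Mbar → KP K n) (i : Fin (n + 1))
    (y : Mbar × sphere (0 : K) 1) : HopfPreimage fbar :=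
  open Classical in
  if h : fbar y.1 ∈ affineDomain i then ⟨(y.1, orbitLift fbar i y), (hopf_orbitLift i y h).symm⟩
  else ⟨(y.1, Function.surjInv hopf_surjective (fbar y.1)),
    (Function.surjInv_eq hopf_surjective (fbar y.1)).symm⟩

theorem coe_preimageLift {i : Fin (n + 1)} {y : Mbar × sphere (0 : K) 1}
    (hy : fbar y.1 ∈ affineDomain i) :
    (preimageLift fbar i y : Mbar × HSphere K n) = (y.1, orbitLift fbar i y) := by
  rw [preimageLift, dif_pos hy]

/-- The trivialization of the preimage of `fbar` over the set where the `i`-th homogeneous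
coordinate does not vanish, as a map to `Mbar × S^{d-1}`. -/
noncomputable def orbitTrivialization (hf : Continuous fbar) (i : Fin (n + 1)) :
    OpenPartialHomeomorph (HopfPreimage fbar) (Mbar × sphere (0 : K) 1) where
  toFun q := (q.1.1, unitCoord i q.1.2)
  invFun := preimageLift fbar i
  source := {q | (q.1.2 : EuclideanSpace K (Fin (n + 1))) i ≠ 0}
  target := {y | fbar y.1 ∈ affineDomain i}
  map_source' q hq := by
    rw [mem_ofPred_eq, q.2]
    exact hq
  map_target' y hy := by
    rw [mem_ofPred_eq, coe_preimageLift hy]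
    exact (hopf_mem_affineDomain i _).1 ((hopf_orbitLift i y hy).symm ▸ hy)
  left_inv' q hq := by
    have h : fbar q.1.1 ∈ affineDomain i := by rw [q.2]; exact hq
    refine Subtype.ext ((coe_preimageLift h).trans (Prod.ext rfl ?_))
    change unitSmul (unitCoord i q.1.2) (affineSection i (affineCoord i (fbar q.1.1))) = q.1.2
    rw [q.2]
    exact unitSmul_unitCoord_affineSection i hq
  right_inv' y hy := by
    rw [coe_preimageLift hy]
    exact Prod.ext rfl (unitCoord_unitSmul_affineSection i _ _)
  open_source := by
    have hc : Continuous fun q : HopfPreimage fbar =>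
        (q.1.2 : EuclideanSpace K (Fin (n + 1))) i :=
      (PiLp.continuous_apply 2 _ i).comp
        (continuous_subtype_val.comp (continuous_snd.comp continuous_subtype_val))
    exact isOpen_ne.preimage hc
  open_target := (affineChart i).open_source.preimage (hf.comp continuous_fst)
  continuousOn_toFun := by
    intro q hq
    refine ContinuousAt.continuousWithinAt ?_
    refine ContinuousAt.prodMk (by fun_prop) ?_
    exact ContinuousAt.comp (f := fun q : HopfPreimage fbar => q.1.2)
      (contMDiffAt_unitCoord i hq).continuousAt (by fun_prop)
  continuousOn_invFun := by
    have h0 : IsInducing (Subtype.val : HopfPreimage fbar → Mbar × HSphere K n) := ⟨rfl⟩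
    refine h0.continuousOn_iff.2 ?_
    have h : ContinuousOn (fun y : Mbar × sphere (0 : K) 1 => (y.1, orbitLift fbar i y))
        {y | fbar y.1 ∈ affineDomain i} := by
      refine continuousOn_fst.prodMk ?_
      have h1 : ContinuousOn (fun y : Mbar × sphere (0 : K) 1 => (y.2, affineCoord i (fbar y.1)))
          {y | fbar y.1 ∈ affineDomain i} :=
        continuousOn_snd.prodMk ((affineChart (K := K) i).continuousOn_toFun.comp
          (hf.comp continuous_fst).continuousOn fun y hy => hy)
      exact (contMDiff_unitSmul_affineSection i).continuous.comp_continuousOn h1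
    exact h.congr fun y hy => coe_preimageLift hy

variable [ChartedSpace (EuclideanSpace ℝ (Fin (finrank ℝ K * n - 1))) Mbar]

/-- A linear identification of the product of the models of `Mbar` and of the sphere of the unit
scalars with the model of the preimage; any one will do. -/
noncomputable def coordEquiv (K : Type*) [NormedDivisionRing K] [InnerProductSpace ℝ K]
    [HopfScalars K] {n : ℕ} (hn : 1 ≤ n) :
    (EuclideanSpace ℝ (Fin (finrank ℝ K * n - 1)) × EuclideanSpace ℝ (Fin (finrank ℝ K - 1)))
      ≃L[ℝ] EuclideanSpace ℝ (Fin (finrank ℝ K * (n + 1) - 2)) :=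
  ContinuousLinearEquiv.ofFinrankEq (by
    have h0 : 0 < finrank ℝ K := finrank_pos
    have h1 : finrank ℝ K * 1 ≤ finrank ℝ K * n := Nat.mul_le_mul_left _ hn
    rw [finrank_prod, finrank_euclideanSpace_fin, finrank_euclideanSpace_fin,
      finrank_euclideanSpace_fin, mul_add]
    omega)

/-- The point of `Mbar × S^{d-1}` given by the trivialization, as a function of a point of
`Mbar × S^{d(n+1)-1}`. -/
noncomputable def trivMap (i : Fin (n + 1)) (y : Mbar × HSphere K n) : Mbar × sphere (0 : K) 1 :=
  (y.1, unitCoord i y.2)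

/-- The charts of the preimage of `fbar`, obtained from the charts of `Mbar × S^{d-1}` by the
trivializations. -/
noncomputable def preimageChart (hn : 1 ≤ n) (hf : Continuous fbar)
    (a : Fin (n + 1) × Mbar × sphere (0 : K) 1) :
    OpenPartialHomeomorph (HopfPreimage fbar)
      (EuclideanSpace ℝ (Fin (finrank ℝ K * (n + 1) - 2))) :=
  ((orbitTrivialization hf a.1).trans
    (chartAt (ModelProd (EuclideanSpace ℝ (Fin (finrank ℝ K * n - 1)))
      (EuclideanSpace ℝ (Fin (finrank ℝ K - 1)))) a.2)).trans
    (coordEquiv K hn).toHomeomorph.toOpenPartialHomeomorph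

/-- The charts of the preimage as functions on `Mbar × S^{d(n+1)-1}`. -/
noncomputable def preimageCoord (hn : 1 ≤ n) (a : Fin (n + 1) × Mbar × sphere (0 : K) 1)
    (y : Mbar × HSphere K n) : EuclideanSpace ℝ (Fin (finrank ℝ K * (n + 1) - 2)) :=
  coordEquiv K hn (extChartAt ((𝓡 (finrank ℝ K * n - 1)).prod (𝓡 (finrank ℝ K - 1))) a.2
    (trivMap a.1 y))

theorem mem_preimageChart_source (hn : 1 ≤ n) (hf : Continuous fbar)
    (a : Fin (n + 1) × Mbar × sphere (0 : K) 1) (q : HopfPreimage fbar) :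
    q ∈ (preimageChart hn hf a).source ↔ (q.1.2 : EuclideanSpace K (Fin (n + 1))) a.1 ≠ 0 ∧
      trivMap a.1 (q : Mbar × HSphere K n) ∈
        (chartAt (ModelProd (EuclideanSpace ℝ (Fin (finrank ℝ K * n - 1)))
          (EuclideanSpace ℝ (Fin (finrank ℝ K - 1)))) a.2).source := by
  rw [preimageChart, OpenPartialHomeomorph.trans_source, OpenPartialHomeomorph.trans_source]
  simp only [Homeomorph.toOpenPartialHomeomorph_source, preimage_univ, inter_univ]
  rfl

variable [IsManifold (𝓡 (finrank ℝ K * n - 1)) ∞ Mbar]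

theorem contMDiffAt_preimageCoord (hn : 1 ≤ n) (hf : Continuous fbar)
    (a : Fin (n + 1) × Mbar × sphere (0 : K) 1) {q : HopfPreimage fbar}
    (hq : q ∈ (preimageChart hn hf a).source) :
    ContMDiffAt ((𝓡 (finrank ℝ K * n - 1)).prod (𝓡 (sphereDim K n)))
      (𝓡 (finrank ℝ K * (n + 1) - 2)) ∞ (preimageCoord hn a) (q : Mbar × HSphere K n) := by
  obtain ⟨h1, h2⟩ := (mem_preimageChart_source hn hf a q).1 hq
  have h3 : ContMDiffAt ((𝓡 (finrank ℝ K * n - 1)).prod (𝓡 (sphereDim K n)))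
      ((𝓡 (finrank ℝ K * n - 1)).prod (𝓡 (finrank ℝ K - 1))) ∞
      (trivMap a.1) (q : Mbar × HSphere K n) := by
    refine contMDiffAt_fst.prodMk ?_
    exact (contMDiffAt_unitCoord a.1 h1).comp (q : Mbar × HSphere K n) contMDiffAt_snd
  have h4 := contMDiffAt_extChartAt' (I := (𝓡 (finrank ℝ K * n - 1)).prod (𝓡 (finrank ℝ K - 1)))
    (n := ∞) h2
  have h5 : ContMDiff 𝓘(ℝ, EuclideanSpace ℝ (Fin (finrank ℝ K * n - 1)) ×
      EuclideanSpace ℝ (Fin (finrank ℝ K - 1))) (𝓡 (finrank ℝ K * (n + 1) - 2)) ∞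
      (coordEquiv K hn) := (coordEquiv K hn).contDiff.contMDiff
  exact (h5.contMDiffAt.comp _ h4).comp _ h3

theorem contMDiffOn_preimageChart_symm (hn : 1 ≤ n)
    (hf : ContMDiff (𝓡 (finrank ℝ K * n - 1)) 𝓘(ℝ, Fin n → K) ∞ fbar)
    (a : Fin (n + 1) × Mbar × sphere (0 : K) 1) :
    ContMDiffOn (𝓡 (finrank ℝ K * (n + 1) - 2))
      ((𝓡 (finrank ℝ K * n - 1)).prod (𝓡 (sphereDim K n))) ∞
      ((fun q : HopfPreimage fbar => (q : Mbar × HSphere K n)) ∘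
        (preimageChart hn hf.continuous a).symm) (preimageChart hn hf.continuous a).target := by
  set c := chartAt (ModelProd (EuclideanSpace ℝ (Fin (finrank ℝ K * n - 1)))
      (EuclideanSpace ℝ (Fin (finrank ℝ K - 1)))) a.2 with hc
  have htarget : ∀ z ∈ (preimageChart hn hf.continuous a).target,
      (coordEquiv K hn).symm z ∈ c.target ∧
      c.symm ((coordEquiv K hn).symm z) ∈
        {y : Mbar × sphere (0 : K) 1 | fbar y.1 ∈ affineDomain a.1} := by
    intro z hz
    rw [preimageChart, OpenPartialHomeomorph.trans_target, OpenPartialHomeomorph.trans_target] at hz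
    exact hz.2
  have h1 : ContMDiffOn (𝓡 (finrank ℝ K * (n + 1) - 2))
      ((𝓡 (finrank ℝ K * n - 1)).prod (𝓡 (finrank ℝ K - 1))) ∞
      (fun z => c.symm ((coordEquiv K hn).symm z)) (preimageChart hn hf.continuous a).target := by
    have h5 : ContMDiff (𝓡 (finrank ℝ K * (n + 1) - 2))
      𝓘(ℝ, EuclideanSpace ℝ (Fin (finrank ℝ K * n - 1)) ×
      EuclideanSpace ℝ (Fin (finrank ℝ K - 1))) ∞
      (coordEquiv K hn).symm := (coordEquiv K hn).symm.contDiff.contMDiff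
    have h6 := contMDiffOn_extChartAt_symm
      (I := (𝓡 (finrank ℝ K * n - 1)).prod (𝓡 (finrank ℝ K - 1))) (n := ∞) a.2
    refine h6.comp h5.contMDiffOn fun z hz => ?_
    rw [mem_preimage, extChartAt_target]
    exact ⟨(htarget z hz).1, by simp⟩
  have h2 : ContMDiffOn ((𝓡 (finrank ℝ K * n - 1)).prod (𝓡 (finrank ℝ K - 1)))
      ((𝓡 (finrank ℝ K * n - 1)).prod (𝓡 (sphereDim K n))) ∞
      (fun y : Mbar × sphere (0 : K) 1 => (y.1, orbitLift fbar a.1 y))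
      {y | fbar y.1 ∈ affineDomain a.1} := by
    refine contMDiffOn_fst.prodMk ?_
    have h7 : ContMDiffOn 𝓘(ℝ, Fin n → K) 𝓘(ℝ, Fin n → K) ∞ (affineChart (K := K) a.1)
        (affineChart a.1).source :=
      contMDiffOn_of_mem_maximalAtlas
        (IsManifold.subset_maximalAtlas (mem_range_self a.1))
    have h8 : ContMDiffOn ((𝓡 (finrank ℝ K * n - 1)).prod (𝓡 (finrank ℝ K - 1)))
        ((𝓡 (finrank ℝ K - 1)).prod 𝓘(ℝ, Fin n → K)) ∞
        (fun y : Mbar × sphere (0 : K) 1 => (y.2, affineCoord a.1 (fbar y.1)))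
        {y | fbar y.1 ∈ affineDomain a.1} :=
      contMDiffOn_snd.prodMk
        (h7.comp (hf.comp contMDiff_fst).contMDiffOn fun y hy => hy)
    exact (contMDiff_unitSmul_affineSection a.1).comp_contMDiffOn h8
  refine (h2.comp h1 fun z hz => (htarget z hz).2).congr fun z hz => ?_
  exact coe_preimageLift (htarget z hz).2

end OrbitCharts

/-! ### Smooth vector fields along a map -/

section TangentBundleLifts

variable {E' H' X : Type*} [NormedAddCommGroup E'] [NormedSpace ℝ E'] [TopologicalSpace H']
  {J : ModelWithCorners ℝ E' H'} [TopologicalSpace X] [ChartedSpace H' X]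

/-- A map to the tangent bundle of a vector space is smooth if its two components are. -/
theorem contMDiff_tangentBundle_vectorSpace {V : Type*} [NormedAddCommGroup V] [NormedSpace ℝ V]
    {b v : X → V} (hb : ContMDiff J 𝓘(ℝ, V) ∞ b) (hv : ContMDiff J 𝓘(ℝ, V) ∞ v) :
    ContMDiff J 𝓘(ℝ, V).tangent ∞ (fun x => (⟨b x, v x⟩ : TangentBundle 𝓘(ℝ, V) V)) := by
  intro x
  refine Bundle.contMDiffAt_totalSpace.2 ⟨hb x, ?_⟩
  refine (hv x).congr_of_eventuallyEq (Filter.Eventually.of_forall fun y => ?_)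
  simp

theorem ContMDiff.mvfderiv_apply {E₂ H₂ N₂ W : Type*} [NormedAddCommGroup E₂] [NormedSpace ℝ E₂]
    [TopologicalSpace H₂] {I : ModelWithCorners ℝ E₂ H₂} [TopologicalSpace N₂]
    [ChartedSpace H₂ N₂] [IsManifold I 1 N₂] [NormedAddCommGroup W] [NormedSpace ℝ W] {Φ : N₂ → W}
    (hΦ : ContMDiff I 𝓘(ℝ, W) ∞ Φ) {b : X → N₂} {v : ∀ x, TangentSpace I (b x)}
    (hv : ContMDiff J I.tangent ∞ (fun x => (⟨b x, v x⟩ : TangentBundle I N₂))) :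
    ContMDiff J 𝓘(ℝ, W) ∞ fun x => mvfderiv I Φ (b x) (v x) :=
  (contMDiff_snd_tangentBundle_modelSpace W 𝓘(ℝ, W)).comp
    ((hΦ.contMDiff_tangentMap (m := ∞) (by norm_cast)).comp hv)

theorem ContMDiff.adjoint_apply {V W : Type*} [NormedAddCommGroup V] [InnerProductSpace ℝ V]
    [CompleteSpace V] [NormedAddCommGroup W] [InnerProductSpace ℝ W] [CompleteSpace W]
    (D : V →L[ℝ] V →L[ℝ] W) {b : X → V} {w : X → W} (hb : ContMDiff J 𝓘(ℝ, V) ∞ b)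
    (hw : ContMDiff J 𝓘(ℝ, W) ∞ w) :
    ContMDiff J 𝓘(ℝ, V) ∞ fun x => ContinuousLinearMap.adjoint (D (b x)) (w x) := by
  have h : ContMDiff J 𝓘(ℝ, W →L[ℝ] V) ∞ fun x => ContinuousLinearMap.adjoint (D (b x)) :=
    ((ContinuousLinearMap.adjoint (𝕜 := ℝ) (E := V) (F := W)).contDiff.comp
      D.contDiff).contMDiff.comp hb
  exact h.clm_apply hw

variable {V : Type*} [NormedAddCommGroup V] [InnerProductSpace ℝ V] {k : ℕ}
  [Fact (finrank ℝ V = k + 1)]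

/-- A vector field along a map to the sphere is smooth if it is smooth as a map to the vector
space. -/
theorem contMDiff_tangentBundle_sphere {b : X → sphere (0 : V) 1}
    {u : ∀ x, TangentSpace (𝓡 k) (b x)}
    (hb : ContMDiff J 𝓘(ℝ, V) ∞ fun x => (b x : V))
    (hu : ContMDiff J 𝓘(ℝ, V) ∞ fun x =>
      mvfderiv (𝓡 k) (Subtype.val : sphere (0 : V) 1 → V) (b x) (u x)) :
    ContMDiff J (𝓡 k).tangent ∞
      (fun x => (⟨b x, u x⟩ : TangentBundle (𝓡 k) (sphere (0 : V) 1))) := by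
  intro x₀
  -- The field is the image of the ambient one under the radial projection to the sphere.
  set ρ := sphereNormalize (b x₀) with hρ
  have h1 : ContMDiffOn 𝓘(ℝ, V) (𝓡 k) ∞ ρ {0}ᶜ := fun v hv =>
    (contMDiffAt_sphereNormalize _ hv).contMDiffWithinAt
  have hopen : IsOpen ({0}ᶜ : Set V) := isOpen_compl_singleton
  have h2 := h1.contMDiffOn_tangentMapWithin (m := ∞) (by norm_cast) hopen.uniqueMDiffOn
  have h3 := contMDiff_tangentBundle_vectorSpace hb hu
  have h4 := h2.comp_contMDiff h3 fun x => ne_zero_of_mem_unit_sphere (b x)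
  refine (h4 x₀).congr_of_eventuallyEq (Filter.Eventually.of_forall fun x => ?_)
  have hb0 : (b x : V) ∈ ({0}ᶜ : Set V) := ne_zero_of_mem_unit_sphere (b x)
  have h5 : MDifferentiableAt 𝓘(ℝ, V) (𝓡 k) ρ (b x : V) :=
    (contMDiffAt_sphereNormalize _ hb0).mdifferentiableAt (by norm_num)
  have h6 : MDifferentiableAt (𝓡 k) 𝓘(ℝ, V) (Subtype.val : sphere (0 : V) 1 → V) (b x) :=
    (contMDiff_coe_sphere (m := 1)).mdifferentiable (by norm_num) _
  have h7 := tangentMap_comp_at (⟨b x, u x⟩ : TangentBundle (𝓡 k) (sphere (0 : V) 1)) h5 h6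
  have h8 : ρ ∘ (Subtype.val : sphere (0 : V) 1 → V) = id :=
    funext fun v => sphereNormalize_coe _ v
  rw [h8, tangentMap_id] at h7
  change _ = tangentMapWithin 𝓘(ℝ, V) (𝓡 k) ρ {0}ᶜ _
  rw [tangentMapWithin_eq_tangentMap (hopen.uniqueMDiffOn _ hb0) h5]
  exact h7

end TangentBundleLifts

/-! ### The lifted normal field -/

theorem mvfderiv_apply_congr_point {E' H' N V : Type*} [NormedAddCommGroup E'] [NormedSpace ℝ E']
    [TopologicalSpace H'] {I : ModelWithCorners ℝ E' H'} [TopologicalSpace N] [ChartedSpace H' N]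
    [NormedAddCommGroup V] [NormedSpace ℝ V] (Φ : N → V) {y y' : N} (h : y = y') (v : E') :
    mvfderiv I Φ y (v : TangentSpace I y) = mvfderiv I Φ y' (v : TangentSpace I y') := by
  subst h
  rfl

section NormalField

variable {K : Type*} [NormedDivisionRing K] [InnerProductSpace ℝ K] [HopfScalars K] {n : ℕ}
  {Mbar : Type*} [TopologicalSpace Mbar]
  [ChartedSpace (EuclideanSpace ℝ (Fin (finrank ℝ K * n - 1))) Mbar]
  [IsManifold (𝓡 (finrank ℝ K * n - 1)) ∞ Mbar] {fbar : Mbar → KP K n}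
  {Nbar : ∀ x : Mbar, TangentSpace 𝓘(ℝ, Fin n → K) (fbar x)}

/-- The horizontal lift of the normal field of `fbar`. -/
noncomputable def preimageNormal (Nbar : ∀ x : Mbar, TangentSpace 𝓘(ℝ, Fin n → K) (fbar x))
    (q : HopfPreimage fbar) : TangentSpace (𝓡 (sphereDim K n)) (preimageMap fbar q) :=
  horizontalLift (preimageMap fbar q) (Nbar q.1.1 : Fin n → K)

/-- The lifted normal field as a map to `K^{n+1}`. -/
noncomputable def ambientNormal (Nbar : ∀ x : Mbar, TangentSpace 𝓘(ℝ, Fin n → K) (fbar x))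
    (q : HopfPreimage fbar) : EuclideanSpace K (Fin (n + 1)) :=
  toAmbient (preimageMap fbar q) (preimageNormal Nbar q)

/-- The point `preimageMap fbar q` as a vector of `K^{n+1}`. -/
noncomputable def ambientMap (fbar : Mbar → KP K n) (q : HopfPreimage fbar) :
    EuclideanSpace K (Fin (n + 1)) :=
  (preimageMap fbar q : EuclideanSpace K (Fin (n + 1)))

theorem norm_ambientMap (q : HopfPreimage fbar) : ‖ambientMap fbar q‖ = 1 :=
  norm_coe_hSphere _

theorem herm_ambientNormal (q : HopfPreimage fbar) :
    herm (ambientNormal Nbar q) (ambientMap fbar q) = 0 :=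
  herm_horizontalLift _ _

theorem mvfderiv_kpStarSq_normal (q : HopfPreimage fbar) :
    mvfderiv 𝓘(ℝ, Fin n → K) kpStarSq (fbar q.1.1) (Nbar q.1.1)
      = starSqDeriv (ambientMap fbar q) (ambientNormal Nbar q) := by
  refine (mvfderiv_apply_congr_point (E' := Fin n → K) kpStarSq q.2 (Nbar q.1.1)).trans ?_
  exact mvfderiv_kpStarSq_eq_starSqDeriv _ _

variable [ChartedSpace (EuclideanSpace ℝ (Fin (finrank ℝ K * (n + 1) - 2))) (HopfPreimage fbar)]
  [IsManifold (𝓡 (finrank ℝ K * (n + 1) - 2)) ∞ (HopfPreimage fbar)]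

theorem contMDiff_preimageMap
    (hj : ContMDiff (𝓡 (finrank ℝ K * (n + 1) - 2))
      ((𝓡 (finrank ℝ K * n - 1)).prod (𝓡 (sphereDim K n))) ∞
      (fun q : HopfPreimage fbar => (q : Mbar × HSphere K n))) :
    ContMDiff (𝓡 (finrank ℝ K * (n + 1) - 2)) (𝓡 (sphereDim K n)) ∞ (preimageMap fbar) :=
  contMDiff_snd.comp hj

theorem contMDiff_preimageProj
    (hj : ContMDiff (𝓡 (finrank ℝ K * (n + 1) - 2))
      ((𝓡 (finrank ℝ K * n - 1)).prod (𝓡 (sphereDim K n))) ∞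
      (fun q : HopfPreimage fbar => (q : Mbar × HSphere K n))) :
    ContMDiff (𝓡 (finrank ℝ K * (n + 1) - 2)) (𝓡 (finrank ℝ K * n - 1)) ∞
      (fun q : HopfPreimage fbar => q.1.1) :=
  contMDiff_fst.comp hj

theorem kpStarSq_comp_proj :
    (kpStarSq ∘ fbar) ∘ (fun q : HopfPreimage fbar => q.1.1)
      = (fun v : EuclideanSpace K (Fin (n + 1)) => starMul v v) ∘ ambientMap fbar := by
  ext1 q
  rw [Function.comp_apply, Function.comp_apply, q.2]
  rfl

/-- The differential of the identity `Φ ∘ fbar ∘ π = Q ∘ f`, with `Φ = kpStarSq` and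
`Q p = p* p`. -/
theorem mvfderiv_kpStarSq_proj
    (hj : ContMDiff (𝓡 (finrank ℝ K * (n + 1) - 2))
      ((𝓡 (finrank ℝ K * n - 1)).prod (𝓡 (sphereDim K n))) ∞
      (fun q : HopfPreimage fbar => (q : Mbar × HSphere K n)))
    (hfbar : ContMDiff (𝓡 (finrank ℝ K * n - 1)) 𝓘(ℝ, Fin n → K) ∞ fbar)
    (q : HopfPreimage fbar) (u : TangentSpace (𝓡 (finrank ℝ K * (n + 1) - 2)) q) :
    mvfderiv 𝓘(ℝ, Fin n → K) kpStarSq (fbar q.1.1)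
      (mfderiv (𝓡 (finrank ℝ K * n - 1)) 𝓘(ℝ, Fin n → K) fbar q.1.1
        (mfderiv (𝓡 (finrank ℝ K * (n + 1) - 2)) (𝓡 (finrank ℝ K * n - 1))
          (fun q : HopfPreimage fbar => q.1.1) q u))
      = starSqDeriv (ambientMap fbar q) (toAmbient (preimageMap fbar q)
        (mfderiv (𝓡 (finrank ℝ K * (n + 1) - 2)) (𝓡 (sphereDim K n)) (preimageMap fbar) q u)) := by
  have hπ := contMDiff_preimageProj hj
  have hf := contMDiff_preimageMap hj
  have h1 := mvfderiv_vector_comp_apply (I₂ := 𝓘(ℝ, Fin n → K))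
    (Φ := kpStarSq) (f := fbar ∘ fun q : HopfPreimage fbar => q.1.1) q
    (contMDiff_kpStarSq.mdifferentiable (by norm_num) _)
    ((hfbar.comp hπ).mdifferentiable (by norm_num) q) u
  rw [mfderiv_comp_apply q (hfbar.mdifferentiable (by norm_num) _)
    (hπ.mdifferentiable (by norm_num) q)] at h1
  refine h1.symm.trans ?_
  have h2 : fbar ∘ (fun q : HopfPreimage fbar => q.1.1) = hopf ∘ preimageMap fbar :=
    funext fun q => q.2
  rw [h2]
  have h3 := mvfderiv_vector_comp_apply (I₂ := 𝓘(ℝ, Fin n → K))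
    (Φ := kpStarSq) (f := hopf ∘ preimageMap fbar) q
    (contMDiff_kpStarSq.mdifferentiable (by norm_num) _)
    ((contMDiff_hopf.comp hf).mdifferentiable (by norm_num) q) u
  rw [mfderiv_comp_apply q (contMDiff_hopf.mdifferentiable (by norm_num) _)
    (hf.mdifferentiable (by norm_num) q)] at h3
  refine h3.trans ?_
  exact mvfderiv_kpStarSq_mfderiv_hopf _ _

theorem isSmoothImmersion_preimageMap
    (hj : IsSmoothImmersion (𝓡 (finrank ℝ K * (n + 1) - 2))
      ((𝓡 (finrank ℝ K * n - 1)).prod (𝓡 (sphereDim K n)))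
      (fun q : HopfPreimage fbar => (q : Mbar × HSphere K n)))
    (hfbar : IsSmoothImmersion (𝓡 (finrank ℝ K * n - 1)) 𝓘(ℝ, Fin n → K) fbar) :
    IsSmoothImmersion (𝓡 (finrank ℝ K * (n + 1) - 2)) (𝓡 (sphereDim K n)) (preimageMap fbar) := by
  refine ⟨contMDiff_preimageMap hj.1, fun q => ?_⟩
  refine (injective_iff_map_eq_zero _).2 fun u hu => ?_
  have h1 := mvfderiv_kpStarSq_proj hj.1 hfbar.1 q u
  rw [hu, toAmbient_eq_mvfderiv, map_zero, map_zero] at h1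
  have h2 := (injective_iff_map_eq_zero _).1 (mvfderiv_kpStarSq_injective _) _ h1
  have h3 := (injective_iff_map_eq_zero _).1 (hfbar.2 q.1.1) _ h2
  refine (injective_iff_map_eq_zero _).1 (hj.2 q) u ?_
  have h4 : mfderiv (𝓡 (finrank ℝ K * (n + 1) - 2))
      ((𝓡 (finrank ℝ K * n - 1)).prod (𝓡 (sphereDim K n)))
      (fun q : HopfPreimage fbar => (q : Mbar × HSphere K n)) q
      = (mfderiv (𝓡 (finrank ℝ K * (n + 1) - 2)) (𝓡 (finrank ℝ K * n - 1))
          (fun q : HopfPreimage fbar => q.1.1) q).prod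
        (mfderiv (𝓡 (finrank ℝ K * (n + 1) - 2)) (𝓡 (sphereDim K n)) (preimageMap fbar) q) :=
    ((contMDiff_preimageProj hj.1).mdifferentiable (by norm_num) q).mfderiv_prod
      ((contMDiff_preimageMap hj.1).mdifferentiable (by norm_num) q)
  rw [h4]
  exact Prod.ext h3 hu

theorem inner_ambientNormal_self
    (hNbar : IsUnitNormalField (m := finrank ℝ K * n - 1) projectiveMetric fbar Nbar)
    (q : HopfPreimage fbar) : inner ℝ (ambientNormal Nbar q) (ambientNormal Nbar q) = 1 := by
  have h := hNbar.unit q.1.1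
  rw [projectiveMetric_eq_inner, mvfderiv_kpStarSq_normal,
    inner_starSqDeriv_starSqDeriv (norm_ambientMap q) _ (herm_ambientNormal q)] at h
  linarith

theorem inner_ambientNormal
    (hNbar : IsUnitNormalField (m := finrank ℝ K * n - 1) projectiveMetric fbar Nbar)
    (hj : ContMDiff (𝓡 (finrank ℝ K * (n + 1) - 2))
      ((𝓡 (finrank ℝ K * n - 1)).prod (𝓡 (sphereDim K n))) ∞
      (fun q : HopfPreimage fbar => (q : Mbar × HSphere K n)))
    (hfbar : ContMDiff (𝓡 (finrank ℝ K * n - 1)) 𝓘(ℝ, Fin n → K) ∞ fbar)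
    (q : HopfPreimage fbar) (u : TangentSpace (𝓡 (finrank ℝ K * (n + 1) - 2)) q) :
    inner ℝ (toAmbient (preimageMap fbar q)
      (mfderiv (𝓡 (finrank ℝ K * (n + 1) - 2)) (𝓡 (sphereDim K n)) (preimageMap fbar) q u))
      (ambientNormal Nbar q) = 0 := by
  have h := hNbar.normal q.1.1 (mfderiv (𝓡 (finrank ℝ K * (n + 1) - 2)) (𝓡 (finrank ℝ K * n - 1))
          (fun q : HopfPreimage fbar => q.1.1) q u)
  rw [projectiveMetric_eq_inner, mvfderiv_kpStarSq_normal, mvfderiv_kpStarSq_proj hj hfbar,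
    inner_starSqDeriv_starSqDeriv (norm_ambientMap q) _ (herm_ambientNormal q)] at h
  linarith

theorem contMDiff_ambientMap
    (hj : ContMDiff (𝓡 (finrank ℝ K * (n + 1) - 2))
      ((𝓡 (finrank ℝ K * n - 1)).prod (𝓡 (sphereDim K n))) ∞
      (fun q : HopfPreimage fbar => (q : Mbar × HSphere K n))) :
    ContMDiff (𝓡 (finrank ℝ K * (n + 1) - 2)) 𝓘(ℝ, EuclideanSpace K (Fin (n + 1))) ∞
      (ambientMap fbar) :=
  contMDiff_coe_sphere.comp (contMDiff_preimageMap hj)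

/-- The lifted normal `a` is a smooth function, as `a = ½ D(p)ᵀ (dΦ Nbar)` with `D = starSqDeriv`,
and the point `p` and the vector `dΦ Nbar` are smooth. -/
theorem contMDiff_ambientNormal
    (hNbar : IsUnitNormalField (m := finrank ℝ K * n - 1) projectiveMetric fbar Nbar)
    (hj : ContMDiff (𝓡 (finrank ℝ K * (n + 1) - 2))
      ((𝓡 (finrank ℝ K * n - 1)).prod (𝓡 (sphereDim K n))) ∞
      (fun q : HopfPreimage fbar => (q : Mbar × HSphere K n))) :
    ContMDiff (𝓡 (finrank ℝ K * (n + 1) - 2)) 𝓘(ℝ, EuclideanSpace K (Fin (n + 1))) ∞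
      (ambientNormal Nbar) := by
  have h1 : ContMDiff (𝓡 (finrank ℝ K * (n + 1) - 2))
      𝓘(ℝ, EuclideanSpace K (Fin (n + 1) × Fin (n + 1))) ∞
      fun q : HopfPreimage fbar => mvfderiv 𝓘(ℝ, Fin n → K) kpStarSq (fbar q.1.1) (Nbar q.1.1) :=
    (contMDiff_kpStarSq.mvfderiv_apply hNbar.smooth).comp (contMDiff_preimageProj hj)
  have _ : CompleteSpace (EuclideanSpace K (Fin (n + 1))) := FiniteDimensional.complete ℝ _
  have _ : CompleteSpace (EuclideanSpace K (Fin (n + 1) × Fin (n + 1))) :=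
    FiniteDimensional.complete ℝ _
  have h2 := (contMDiff_ambientMap hj).adjoint_apply starSqDeriv h1
  have h3 := (contDiff_const_smul (1 / 2 : ℝ)).contMDiff.comp h2
  refine h3.congr fun q => ?_
  refine ext_inner_left ℝ fun b => ?_
  rw [Function.comp_apply, mvfderiv_kpStarSq_normal, real_inner_smul_right,
    ContinuousLinearMap.adjoint_inner_right]
  have h4 := inner_starSqDeriv_starSqDeriv (norm_ambientMap q) b
    (herm_ambientNormal (Nbar := Nbar) q)
  rw [h4]
  ring

theorem isUnitNormalField_preimageNormal
    (hNbar : IsUnitNormalField (m := finrank ℝ K * n - 1) projectiveMetric fbar Nbar)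
    (hj : ContMDiff (𝓡 (finrank ℝ K * (n + 1) - 2))
      ((𝓡 (finrank ℝ K * n - 1)).prod (𝓡 (sphereDim K n))) ∞
      (fun q : HopfPreimage fbar => (q : Mbar × HSphere K n)))
    (hfbar : ContMDiff (𝓡 (finrank ℝ K * n - 1)) 𝓘(ℝ, Fin n → K) ∞ fbar) :
    IsUnitNormalField (m := finrank ℝ K * (n + 1) - 2) sphereMetric (preimageMap fbar)
      (preimageNormal Nbar) where
  smooth := contMDiff_tangentBundle_sphere (contMDiff_ambientMap hj)
    (contMDiff_ambientNormal hNbar hj)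
  unit q := inner_ambientNormal_self hNbar q
  normal q u := inner_ambientNormal hNbar hj hfbar q u

end NormalField

/-! ### Orthonormal frames -/

section Frames

variable {V : Type*} [NormedAddCommGroup V] [InnerProductSpace ℝ V]

theorem Orthonormal.option_elim {ι : Type*} {u : ι → V} (hu : Orthonormal ℝ u) {a : V}
    (ha : ‖a‖ = 1) (h : ∀ i, inner ℝ (u i) a = 0) :
    Orthonormal ℝ (fun o : Option ι => o.elim a u) := by
  refine ⟨?_, ?_⟩
  · rintro (_ | i)
    · exact ha
    · exact hu.1 i
  · rintro (_ | i) (_ | j) hij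
    · exact absurd rfl hij
    · exact (real_inner_comm _ _).trans (h j)
    · exact h i
    · exact hu.2 fun h => hij (congrArg some h)

/-- An orthonormal family with two elements less than the dimension, and two orthonormal vectors
orthogonal to it, form an orthonormal basis. -/
theorem exists_orthonormalBasis_of_codim_two [FiniteDimensional ℝ V] {ι : Type*} [Fintype ι]
    {u : ι → V} (hu : Orthonormal ℝ u) {p a : V} (hp : ‖p‖ = 1) (ha : ‖a‖ = 1)
    (hpa : inner ℝ a p = 0) (hup : ∀ i, inner ℝ (u i) p = 0) (hua : ∀ i, inner ℝ (u i) a = 0)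
    (hcard : Fintype.card ι + 2 = finrank ℝ V) :
    ∃ b : OrthonormalBasis (Option (Option ι)) ℝ V,
      b none = p ∧ b (some none) = a ∧ ∀ i, b (some (some i)) = u i := by
  have h1 := (hu.option_elim ha hua).option_elim hp (by
    rintro (_ | i)
    · exact hpa
    · exact hup i)
  have h2 : Fintype.card (Option (Option ι)) = finrank ℝ V := by
    rw [Fintype.card_option, Fintype.card_option, ← hcard]
  have h3 := h1.linearIndependent.span_eq_top_of_card_eq_finrank' h2
  exact ⟨OrthonormalBasis.mk h1 h3.ge, by simp, by simp, by simp⟩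

/-- An injective linear map to a Euclidean space induces, after scaling by `κ`, an inner product;
this is an orthonormal basis for it. -/
theorem exists_frame_of_injective {m : ℕ} {κ : ℝ} (hκ : 0 < κ)
    (L : EuclideanSpace ℝ (Fin m) →L[ℝ] V) (hL : Function.Injective L) :
    ∃ b : Fin m → EuclideanSpace ℝ (Fin m),
      (∀ i j, κ * inner ℝ (L (b i)) (L (b j)) = if i = j then 1 else 0) ∧
      ∀ v, v = ∑ j, (κ * inner ℝ (L v) (L (b j))) • b j := by
  have hr : finrank ℝ (LinearMap.range (L : EuclideanSpace ℝ (Fin m) →ₗ[ℝ] V)) = m := by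
    rw [LinearMap.finrank_range_of_inj hL, finrank_euclideanSpace_fin]
  let c := (stdOrthonormalBasis ℝ
    (LinearMap.range (L : EuclideanSpace ℝ (Fin m) →ₗ[ℝ] V))).reindex (finCongr hr)
  choose b0 hb0 using fun j => (c j).2
  have hs : √κ ≠ 0 := (Real.sqrt_pos.2 hκ).ne'
  have hss : κ * ((√κ)⁻¹ * (√κ)⁻¹) = 1 := by
    rw [← mul_inv, Real.mul_self_sqrt hκ.le, mul_inv_cancel₀ hκ.ne']
  have hLb : ∀ j, L ((√κ)⁻¹ • b0 j) = (√κ)⁻¹ • (c j : V) := fun j => by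
    rw [map_smul]
    exact congrArg _ (hb0 j)
  refine ⟨fun j => (√κ)⁻¹ • b0 j, fun i j => ?_, fun v => hL ?_⟩
  · have h := orthonormal_iff_ite.1 c.orthonormal i j
    rw [Submodule.coe_inner] at h
    rw [hLb, hLb, real_inner_smul_left, real_inner_smul_right, h, ← mul_assoc, ← mul_assoc,
      mul_assoc κ, hss, one_mul]
  · rw [map_sum]
    have h := c.sum_repr' ⟨L v, ⟨v, rfl⟩⟩
    have h' := congrArg (Subtype.val) h
    rw [AddSubmonoidClass.coe_finsetSum] at h'
    refine h'.symm.trans (Finset.sum_congr rfl fun j _ => ?_)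
    simp only [map_smul L _ ((√κ)⁻¹ • b0 j), hLb]
    rw [real_inner_smul_right, smul_smul, Submodule.coe_smul, Submodule.coe_inner, real_inner_comm]
    congr 1
    linear_combination (-(inner ℝ (L v) (c j : V))) * hss

/-- If the columns `t · j` of the coefficients are orthonormal, `B` has the same trace over the two
families. -/
theorem sum_bilin_eq_of_coeffs {E ι κ : Type*} [AddCommGroup E] [Module ℝ E] [Fintype ι] [Fintype κ]
    [DecidableEq κ] (B : E →ₗ[ℝ] E →ₗ[ℝ] ℝ) {w : ι → E} {b : κ → E} {t : ι → κ → ℝ}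
    (hw : ∀ i, w i = ∑ j, t i j • b j)
    (ht : ∀ j k, ∑ i, t i j * t i k = if j = k then 1 else 0) :
    ∑ i, B (w i) (w i) = ∑ j, B (b j) (b j) := by
  have h : ∀ i, B (w i) (w i) = ∑ j, ∑ k, t i j * t i k * B (b j) (b k) := by
    intro i
    rw [hw i]
    simp only [map_sum, LinearMap.sum_apply, map_smul, LinearMap.smul_apply, smul_eq_mul,
      Finset.mul_sum]
    rw [Finset.sum_comm]
    refine Finset.sum_congr rfl fun j _ => Finset.sum_congr rfl fun k _ => ?_
    ring
  simp only [h]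
  rw [Finset.sum_comm]
  refine Finset.sum_congr rfl fun j _ => ?_
  rw [Finset.sum_comm]
  simp only [← Finset.sum_mul, ht]
  simp

end Frames

/-! ### Comparison of the second fundamental forms -/

/-- The second derivative of an identity `G ∘ P = B (H, H)` with `B` bilinear. -/
theorem fderiv_fderiv_comp_eq_bilinear {E E' V W : Type*} [NormedAddCommGroup E] [NormedSpace ℝ E]
    [NormedAddCommGroup E'] [NormedSpace ℝ E'] [NormedAddCommGroup V] [NormedSpace ℝ V]
    [NormedAddCommGroup W] [NormedSpace ℝ W] (B : V →L[ℝ] V →L[ℝ] W) {G : E' → W} {P : E → E'}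
    {H : E → V} {p : E} (hG : ContDiffAt ℝ 2 G (P p)) (hP : ContDiffAt ℝ 2 P p)
    (hH : ContDiffAt ℝ 2 H p) (h : G ∘ P =ᶠ[𝓝 p] (fun v => B v v) ∘ H) (v : E) :
    fderiv ℝ (fderiv ℝ G) (P p) (fderiv ℝ P p v) (fderiv ℝ P p v)
        + fderiv ℝ G (P p) (fderiv ℝ (fderiv ℝ P) p v v)
      = (B (fderiv ℝ H p v) (fderiv ℝ H p v) + B (fderiv ℝ H p v) (fderiv ℝ H p v))
        + (B + B.flip) (H p) (fderiv ℝ (fderiv ℝ H) p v v) := by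
  rw [← fderiv_fderiv_comp hG hP, h.fderiv.fderiv_eq,
    fderiv_fderiv_comp B.contDiff_apply_self.contDiffAt hH, B.fderiv_fderiv_apply_self,
    (B.hasFDerivAt_apply_self (H p)).fderiv]
  rfl

/-- The component of `fderiv_fderiv_comp_eq_bilinear` in the direction `η`. -/
theorem half_inner_fderiv_fderiv_eq {E E' V W : Type*} [NormedAddCommGroup E] [NormedSpace ℝ E]
    [NormedAddCommGroup E'] [NormedSpace ℝ E'] [NormedAddCommGroup V] [InnerProductSpace ℝ V]
    [NormedAddCommGroup W] [InnerProductSpace ℝ W] (B : V →L[ℝ] V →L[ℝ] W) {G : E' → W} {P : E → E'}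
    {H : E → V} {p : E} (hG : ContDiffAt ℝ 2 G (P p)) (hP : ContDiffAt ℝ 2 P p)
    (hH : ContDiffAt ℝ 2 H p) (h : G ∘ P =ᶠ[𝓝 p] (fun v => B v v) ∘ H) {η : W} {a : V}
    (hη : ∀ c, inner ℝ (fderiv ℝ G (P p) c) η = 0)
    (ha : ∀ b, inner ℝ ((B + B.flip) (H p) b) η = 2 * inner ℝ b a) (v : E) :
    1 / 2 * inner ℝ (fderiv ℝ (fderiv ℝ G) (P p) (fderiv ℝ P p v) (fderiv ℝ P p v)) η
      = inner ℝ (fderiv ℝ (fderiv ℝ H) p v v) a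
        + inner ℝ (B (fderiv ℝ H p v) (fderiv ℝ H p v)) η := by
  have h1 := congrArg (fun x => inner ℝ x η) (fderiv_fderiv_comp_eq_bilinear B hG hP hH h v)
  simp only [inner_add_left, hη, ha] at h1
  linarith

section SecondFundamentalForms

variable {K : Type*} [NormedDivisionRing K] [InnerProductSpace ℝ K] [HopfScalars K] {n : ℕ}
  {Mbar : Type*} [TopologicalSpace Mbar]
  [ChartedSpace (EuclideanSpace ℝ (Fin (finrank ℝ K * n - 1))) Mbar]
  [IsManifold (𝓡 (finrank ℝ K * n - 1)) ∞ Mbar] {fbar : Mbar → KP K n}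
  {Nbar : ∀ x : Mbar, TangentSpace 𝓘(ℝ, Fin n → K) (fbar x)}

/-- The differential of `kpStarSq ∘ fbar`. -/
noncomputable def embDeriv (fbar : Mbar → KP K n) (x : Mbar) :
    EuclideanSpace ℝ (Fin (finrank ℝ K * n - 1))
      →L[ℝ] EuclideanSpace K (Fin (n + 1) × Fin (n + 1)) :=
  (mvfderiv 𝓘(ℝ, Fin n → K) kpStarSq (fbar x)).comp
    (mfderiv (𝓡 (finrank ℝ K * n - 1)) 𝓘(ℝ, Fin n → K) fbar x)

theorem embDeriv_eq_fderiv
    (hfbar : ContMDiff (𝓡 (finrank ℝ K * n - 1)) 𝓘(ℝ, Fin n → K) ∞ fbar) (x : Mbar) :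
    embDeriv fbar x = fderiv ℝ ((kpStarSq ∘ fbar) ∘ (extChartAt (𝓡 (finrank ℝ K * n - 1)) x).symm)
      (extChartAt (𝓡 (finrank ℝ K * n - 1)) x x) := by
  rw [← mvfderiv_eq_fderiv_comp_extChartAt_symm
    ((contMDiff_kpStarSq.comp hfbar).mdifferentiable (by norm_num) x)]
  ext1 v
  exact (mvfderiv_vector_comp_apply x (contMDiff_kpStarSq.mdifferentiable (by norm_num) _)
    (hfbar.mdifferentiable (by norm_num) x) v).symm

theorem embDeriv_injective
    (hfbar : IsSmoothImmersion (𝓡 (finrank ℝ K * n - 1)) 𝓘(ℝ, Fin n → K) fbar) (x : Mbar) :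
    Function.Injective (embDeriv fbar x) :=
  (mvfderiv_kpStarSq_injective (fbar x)).comp (hfbar.2 x)

theorem inner_embDeriv_normal
    (hNbar : IsUnitNormalField (m := finrank ℝ K * n - 1) projectiveMetric fbar Nbar)
    (x : Mbar) (v : EuclideanSpace ℝ (Fin (finrank ℝ K * n - 1))) :
    inner ℝ (embDeriv fbar x v) (mvfderiv 𝓘(ℝ, Fin n → K) kpStarSq (fbar x) (Nbar x)) = 0 := by
  have h := hNbar.normal x v
  rw [projectiveMetric_eq_inner] at h
  have h1 : 1 / 2 * inner ℝ (embDeriv fbar x v)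
    (mvfderiv 𝓘(ℝ, Fin n → K) kpStarSq (fbar x) (Nbar x)) = 0 := h
  linarith

/-- Every tangent vector of the hypersurface of the projective space is, in the space of matrices,
the image of a horizontal vector. -/
theorem exists_embDeriv_eq_starSqDeriv (q : HopfPreimage fbar)
    (v : EuclideanSpace ℝ (Fin (finrank ℝ K * n - 1))) :
    ∃ β : EuclideanSpace K (Fin (n + 1)), herm β (ambientMap fbar q) = 0 ∧
      embDeriv fbar q.1.1 v = starSqDeriv (ambientMap fbar q) β := by
  refine ⟨_, herm_horizontalLift (preimageMap fbar q)
    (mfderiv (𝓡 (finrank ℝ K * n - 1)) 𝓘(ℝ, Fin n → K) fbar q.1.1 v : Fin n → K), ?_⟩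
  refine (mvfderiv_apply_congr_point (E' := Fin n → K) kpStarSq q.2 _).trans ?_
  exact mvfderiv_kpStarSq_eq_starSqDeriv _ _

/-- The second derivative of `kpStarSq ∘ fbar` in the preferred chart at `x`. -/
noncomputable def embSndDeriv (fbar : Mbar → KP K n) (x : Mbar) :
    EuclideanSpace ℝ (Fin (finrank ℝ K * n - 1)) →L[ℝ]
      EuclideanSpace ℝ (Fin (finrank ℝ K * n - 1)) →L[ℝ]
      EuclideanSpace K (Fin (n + 1) × Fin (n + 1)) :=
  fderiv ℝ (fderiv ℝ ((kpStarSq ∘ fbar) ∘ (extChartAt (𝓡 (finrank ℝ K * n - 1)) x).symm))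
    (extChartAt (𝓡 (finrank ℝ K * n - 1)) x x)

theorem secondFundamentalForm_projective
    (hfbar : ContMDiff (𝓡 (finrank ℝ K * n - 1)) 𝓘(ℝ, Fin n → K) ∞ fbar) (x : Mbar)
    (v : EuclideanSpace ℝ (Fin (finrank ℝ K * n - 1))) :
    secondFundamentalForm (m := finrank ℝ K * n - 1) projectiveMetric fbar x (Nbar x) v v
      = 1 / 2 * inner ℝ (embSndDeriv fbar x v v)
        (mvfderiv 𝓘(ℝ, Fin n → K) kpStarSq (fbar x) (Nbar x)) := by
  have h := secondFundamentalForm_eq_inner (g := projectiveMetric (K := K) (n := n)) (κ := 1 / 2)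
    (Φ := kpStarSq) contMDiff_kpStarSq projectiveMetric_eq_inner hfbar x (Nbar x) v v
  exact h

variable [ChartedSpace (EuclideanSpace ℝ (Fin (finrank ℝ K * (n + 1) - 2))) (HopfPreimage fbar)]
  [IsManifold (𝓡 (finrank ℝ K * (n + 1) - 2)) ∞ (HopfPreimage fbar)]

/-- The differential of the projection of the preimage to `Mbar`. -/
noncomputable def projDeriv (q : HopfPreimage fbar) :
    EuclideanSpace ℝ (Fin (finrank ℝ K * (n + 1) - 2))
      →L[ℝ] EuclideanSpace ℝ (Fin (finrank ℝ K * n - 1)) :=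
  mfderiv (𝓡 (finrank ℝ K * (n + 1) - 2)) (𝓡 (finrank ℝ K * n - 1))
    (fun q : HopfPreimage fbar => q.1.1) q

/-- The differential of the map of the preimage to `K^{n+1}`. -/
noncomputable def ambientDeriv (q : HopfPreimage fbar) :
    EuclideanSpace ℝ (Fin (finrank ℝ K * (n + 1) - 2)) →L[ℝ] EuclideanSpace K (Fin (n + 1)) :=
  (mvfderiv (𝓡 (sphereDim K n))
    (fun p : HSphere K n => (p : EuclideanSpace K (Fin (n + 1)))) (preimageMap fbar q)).comp
    (mfderiv (𝓡 (finrank ℝ K * (n + 1) - 2)) (𝓡 (sphereDim K n)) (preimageMap fbar) q)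

/-- The differential of the identity `Φ ∘ fbar ∘ π = Q ∘ f`, with `Φ = kpStarSq` and
`Q p = p* p`. -/
theorem embDeriv_projDeriv
    (hj : ContMDiff (𝓡 (finrank ℝ K * (n + 1) - 2))
      ((𝓡 (finrank ℝ K * n - 1)).prod (𝓡 (sphereDim K n))) ∞
      (fun q : HopfPreimage fbar => (q : Mbar × HSphere K n)))
    (hfbar : ContMDiff (𝓡 (finrank ℝ K * n - 1)) 𝓘(ℝ, Fin n → K) ∞ fbar)
    (q : HopfPreimage fbar) (u : EuclideanSpace ℝ (Fin (finrank ℝ K * (n + 1) - 2))) :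
    embDeriv fbar q.1.1 (projDeriv q u) = starSqDeriv (ambientMap fbar q) (ambientDeriv q u) :=
  mvfderiv_kpStarSq_proj hj hfbar q u

theorem ambientDeriv_eq_fderiv
    (hj : ContMDiff (𝓡 (finrank ℝ K * (n + 1) - 2))
      ((𝓡 (finrank ℝ K * n - 1)).prod (𝓡 (sphereDim K n))) ∞
      (fun q : HopfPreimage fbar => (q : Mbar × HSphere K n))) (q : HopfPreimage fbar) :
    ambientDeriv q
      = fderiv ℝ (ambientMap fbar ∘ (extChartAt (𝓡 (finrank ℝ K * (n + 1) - 2)) q).symm)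
        (extChartAt (𝓡 (finrank ℝ K * (n + 1) - 2)) q q) := by
  rw [← mvfderiv_eq_fderiv_comp_extChartAt_symm
    ((contMDiff_ambientMap hj).mdifferentiable (by norm_num) q)]
  ext1 v
  exact (mvfderiv_vector_comp_apply q (mdifferentiable_coe_sphere _)
    ((contMDiff_preimageMap hj).mdifferentiable (by norm_num) q) v).symm

theorem projDeriv_eq_fderiv
    (hj : ContMDiff (𝓡 (finrank ℝ K * (n + 1) - 2))
      ((𝓡 (finrank ℝ K * n - 1)).prod (𝓡 (sphereDim K n))) ∞
      (fun q : HopfPreimage fbar => (q : Mbar × HSphere K n))) (q : HopfPreimage fbar) :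
    projDeriv q = fderiv ℝ (writtenInExtChartAt (𝓡 (finrank ℝ K * (n + 1) - 2))
        (𝓡 (finrank ℝ K * n - 1)) q (fun q : HopfPreimage fbar => q.1.1))
      (extChartAt (𝓡 (finrank ℝ K * (n + 1) - 2)) q q) := by
  rw [projDeriv, ((contMDiff_preimageProj hj).mdifferentiable (by norm_num) q).mfderiv,
    ModelWithCorners.range_eq_univ, fderivWithin_univ]

/-- As the sphere is isometrically included in `K^{n+1}`, the second fundamental forms of its
hypersurfaces are components of second derivatives there. -/
theorem secondFundamentalForm_preimage
    (hj : ContMDiff (𝓡 (finrank ℝ K * (n + 1) - 2))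
      ((𝓡 (finrank ℝ K * n - 1)).prod (𝓡 (sphereDim K n))) ∞
      (fun q : HopfPreimage fbar => (q : Mbar × HSphere K n)))
    (q : HopfPreimage fbar) (v : EuclideanSpace ℝ (Fin (finrank ℝ K * (n + 1) - 2))) :
    secondFundamentalForm (m := finrank ℝ K * (n + 1) - 2) sphereMetric (preimageMap fbar)
        q (preimageNormal Nbar q) v v
      = inner ℝ (fderiv ℝ (fderiv ℝ
          (ambientMap fbar ∘ (extChartAt (𝓡 (finrank ℝ K * (n + 1) - 2)) q).symm))
        (extChartAt (𝓡 (finrank ℝ K * (n + 1) - 2)) q q) v v) (ambientNormal Nbar q) := by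
  have hc : ContMDiff (𝓡 (sphereDim K n)) 𝓘(ℝ, EuclideanSpace K (Fin (n + 1))) ∞
    (fun p : HSphere K n => (p : EuclideanSpace K (Fin (n + 1)))) := contMDiff_coe_sphere
  have h := secondFundamentalForm_eq_inner (g := sphereMetric) (κ := 1)
    (Φ := fun p : HSphere K n => (p : EuclideanSpace K (Fin (n + 1)))) hc
    sphereMetric_eq_inner (contMDiff_preimageMap hj) q (preimageNormal Nbar q) v v
  rw [one_mul] at h
  exact h

/-- The relation between the second fundamental forms of the hypersurface and of its preimage, from
the second derivative of `Φ ∘ fbar ∘ π = Q ∘ f`, with `Φ = kpStarSq` and `Q p = p* p`: the last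
term comes from the second derivative `2 u* u` of `Q`, and the second derivative of `π` does not
contribute, as the image of `d(Φ ∘ fbar)` is orthogonal to the normal. -/
theorem secondFundamentalForm_proj
    (hNbar : IsUnitNormalField (m := finrank ℝ K * n - 1) projectiveMetric fbar Nbar)
    (hj : ContMDiff (𝓡 (finrank ℝ K * (n + 1) - 2))
      ((𝓡 (finrank ℝ K * n - 1)).prod (𝓡 (sphereDim K n))) ∞
      (fun q : HopfPreimage fbar => (q : Mbar × HSphere K n)))
    (hfbar : ContMDiff (𝓡 (finrank ℝ K * n - 1)) 𝓘(ℝ, Fin n → K) ∞ fbar)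
    (q : HopfPreimage fbar) (v : EuclideanSpace ℝ (Fin (finrank ℝ K * (n + 1) - 2))) :
    secondFundamentalForm (m := finrank ℝ K * n - 1) projectiveMetric fbar q.1.1
        (Nbar q.1.1) (projDeriv q v) (projDeriv q v)
      = secondFundamentalForm (m := finrank ℝ K * (n + 1) - 2) sphereMetric (preimageMap fbar)
        q (preimageNormal Nbar q) v v
        + 2 * hermForm (ambientMap fbar q) (ambientNormal Nbar q)
          (ambientDeriv q v) (ambientDeriv q v) := by
  have hπ := contMDiff_preimageProj hj
  rw [secondFundamentalForm_projective hfbar, secondFundamentalForm_preimage hj]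
  set e := extChartAt (𝓡 (finrank ℝ K * (n + 1) - 2)) q with he
  set P := writtenInExtChartAt (𝓡 (finrank ℝ K * (n + 1) - 2)) (𝓡 (finrank ℝ K * n - 1)) q
    (fun q : HopfPreimage fbar => q.1.1) with hP
  have hp := mem_extChartAt_target (I := 𝓡 (finrank ℝ K * (n + 1) - 2)) q
  have hPp : P (e q) = extChartAt (𝓡 (finrank ℝ K * n - 1)) q.1.1 q.1.1 := by
    simp [hP, he, writtenInExtChartAt]
  have hG2 : ContDiffAt ℝ 2 ((kpStarSq ∘ fbar) ∘
      (extChartAt (𝓡 (finrank ℝ K * n - 1)) q.1.1).symm) (P (e q)) := by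
    rw [hPp]
    exact ((contMDiff_kpStarSq.comp hfbar).contDiffAt_comp_extChartAt_symm _
      (mem_extChartAt_target q.1.1)).of_le (by norm_cast)
  have hH2 : ContDiffAt ℝ 2 (ambientMap fbar ∘ e.symm) (e q) :=
    ((contMDiff_ambientMap hj).contDiffAt_comp_extChartAt_symm q hp).of_le (by norm_cast)
  have hP2 : ContDiffAt ℝ 2 P (e q) := by
    have h := (contMDiffAt_iff.1 (hπ q)).2
    rw [ModelWithCorners.range_eq_univ, contDiffWithinAt_univ] at h
    exact h.of_le (by norm_cast)
  have hev : ((kpStarSq ∘ fbar) ∘ (extChartAt (𝓡 (finrank ℝ K * n - 1)) q.1.1).symm) ∘ P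
      =ᶠ[𝓝 (e q)] (fun v : EuclideanSpace K (Fin (n + 1)) => starMul v v)
        ∘ (ambientMap fbar ∘ e.symm) := by
    have hc : ContinuousAt ((fun q : HopfPreimage fbar => q.1.1) ∘ e.symm) (e q) :=
      hπ.continuous.continuousAt.comp (continuousAt_extChartAt_symm q)
    have hmem : (extChartAt (𝓡 (finrank ℝ K * n - 1)) q.1.1).source
        ∈ 𝓝 (((fun q : HopfPreimage fbar => q.1.1) ∘ e.symm) (e q)) := by
      rw [Function.comp_apply, he, extChartAt_to_inv]
      exact extChartAt_source_mem_nhds q.1.1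
    filter_upwards [hc.preimage_mem_nhds hmem] with z hz
    rw [← Function.comp_assoc, ← kpStarSq_comp_proj]
    simp only [hP, writtenInExtChartAt, Function.comp_apply]
    rw [PartialEquiv.left_inv _ hz]
  have h2 : (ambientMap fbar ∘ e.symm) (e q) = ambientMap fbar q := by
    rw [Function.comp_apply, he, extChartAt_to_inv]
  have h4 : inner ℝ (starMul (ambientDeriv q v) (ambientDeriv q v))
      (starSqDeriv (ambientMap fbar q) (ambientNormal Nbar q))
      = 2 * hermForm (ambientMap fbar q) (ambientNormal Nbar q)
          (ambientDeriv q v) (ambientDeriv q v) := by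
    rw [starSqDeriv_apply, inner_add_right, inner_starMul_starMul, inner_starMul_starMul,
      hermForm_apply, real_inner_comm (herm (ambientMap fbar q) _)]
    ring
  have h5 : ∀ c, inner ℝ (fderiv ℝ ((kpStarSq ∘ fbar) ∘
      (extChartAt (𝓡 (finrank ℝ K * n - 1)) q.1.1).symm) (P (e q)) c)
      (starSqDeriv (ambientMap fbar q) (ambientNormal Nbar q)) = 0 := by
    intro c
    rw [hPp, ← embDeriv_eq_fderiv hfbar, ← mvfderiv_kpStarSq_normal]
    exact inner_embDeriv_normal hNbar _ c
  have h6 : ∀ b, inner ℝ (starSqDeriv ((ambientMap fbar ∘ e.symm) (e q)) b)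
      (starSqDeriv (ambientMap fbar q) (ambientNormal Nbar q))
      = 2 * inner ℝ b (ambientNormal Nbar q) := by
    intro b
    rw [h2]
    exact inner_starSqDeriv_starSqDeriv (norm_ambientMap q) b (herm_ambientNormal q)
  have key := half_inner_fderiv_fderiv_eq (starMul (K := K) (ι := Fin (n + 1))) hG2 hP2 hH2 hev
    h5 h6 v
  rw [hPp, ← projDeriv_eq_fderiv hj, ← ambientDeriv_eq_fderiv hj, h4] at key
  rw [mvfderiv_kpStarSq_normal]
  exact key

end SecondFundamentalForms

/-! ### Minimality of the preimage -/

/-- The Parseval identity for vectors orthogonal to two elements of the basis. -/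
theorem OrthonormalBasis.sum_inner_mul_inner_option {V : Type*} [NormedAddCommGroup V]
    [InnerProductSpace ℝ V] {ι : Type*} [Fintype ι]
    (b : OrthonormalBasis (Option (Option ι)) ℝ V) {β γ : V} (h₁ : inner ℝ β (b none) = 0)
    (h₂ : inner ℝ β (b (some none)) = 0) :
    ∑ i, inner ℝ (b (some (some i))) β * inner ℝ (b (some (some i))) γ = inner ℝ β γ := by
  have h := b.sum_inner_mul_inner β γ
  rw [Fintype.sum_option, Fintype.sum_option, h₁, h₂, zero_mul, zero_add, zero_mul, zero_add] at h
  rw [← h]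
  exact Finset.sum_congr rfl fun i _ => by rw [real_inner_comm]

section HermitianTrace

variable {K : Type*} [NormedDivisionRing K] [InnerProductSpace ℝ K] [HopfScalars K]
  {κ : Type*} [Fintype κ]

/-- The trace of `hermForm p a` is not affected by the removal of the directions `p` and `a`. -/
theorem sum_hermForm_option_eq_zero {ι : Type*} [Fintype ι] {p a : EuclideanSpace K κ}
    (ha : herm a p = 0) (b : OrthonormalBasis (Option (Option ι)) ℝ (EuclideanSpace K κ))
    (hp : b none = p) (hb : b (some none) = a) :
    ∑ i, hermForm p a (b (some (some i))) (b (some (some i))) = 0 := by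
  have hpa : herm p a = 0 := herm_eq_zero_comm.1 ha
  have h := sum_hermForm_eq_zero b (inner_eq_zero_of_herm_eq_zero hpa)
  have h1 : hermForm p a p p = 0 := by rw [hermForm_apply, ha, inner_zero_right]
  have h2 : hermForm p a a a = 0 := by rw [hermForm_apply, hpa, inner_zero_left]
  rw [Fintype.sum_option, Fintype.sum_option, hp, hb, h1, h2, zero_add, zero_add] at h
  exact h

end HermitianTrace

section Minimality

variable {K : Type*} [NormedDivisionRing K] [InnerProductSpace ℝ K] [HopfScalars K] {n : ℕ}
  {Mbar : Type*} [TopologicalSpace Mbar]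
  [ChartedSpace (EuclideanSpace ℝ (Fin (finrank ℝ K * n - 1))) Mbar]
  [IsManifold (𝓡 (finrank ℝ K * n - 1)) ∞ Mbar] {fbar : Mbar → KP K n}
  {Nbar : ∀ x : Mbar, TangentSpace 𝓘(ℝ, Fin n → K) (fbar x)}

/-- An orthonormal frame of a minimal hypersurface of the projective space, and the vanishing of
the mean curvature, in terms of the derivatives of `Φ ∘ fbar` with `Φ = kpStarSq`. -/
theorem exists_frame_of_isMinimalAlong
    (hfbar : IsSmoothImmersion (𝓡 (finrank ℝ K * n - 1)) 𝓘(ℝ, Fin n → K) fbar)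
    (hmin : IsMinimalAlong (m := finrank ℝ K * n - 1) projectiveMetric fbar Nbar) (x : Mbar) :
    ∃ b : Fin (finrank ℝ K * n - 1) → EuclideanSpace ℝ (Fin (finrank ℝ K * n - 1)),
      (∀ i j, 1 / 2 * inner ℝ (embDeriv fbar x (b i)) (embDeriv fbar x (b j))
        = if i = j then 1 else 0) ∧
      (∀ v, v = ∑ j, (1 / 2 * inner ℝ (embDeriv fbar x v) (embDeriv fbar x (b j))) • b j) ∧
      ∑ j, 1 / 2 * inner ℝ (embSndDeriv fbar x (b j) (b j))
        (mvfderiv 𝓘(ℝ, Fin n → K) kpStarSq (fbar x) (Nbar x)) = 0 := by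
  obtain ⟨b, hb, hv⟩ := exists_frame_of_injective (κ := 1 / 2) (by norm_num) (embDeriv fbar x)
    (embDeriv_injective hfbar x)
  refine ⟨b, hb, hv, ?_⟩
  have h := hmin x b fun i j => by
    rw [projectiveMetric_eq_inner]
    exact hb i j
  simpa only [secondFundamentalForm_projective hfbar.1] using h

/-- The mean curvature may be computed with any family `w` such that
`∑ᵢ g(wᵢ, c) g(wᵢ, c') = g(c, c')` for all `c`, `c'`.
The horizontal and vertical components of an orthonormal frame of the preimage are in general both
nonzero, so its projection is not an orthonormal basis, and in general has more members than the
dimension, but it is such a family. -/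
theorem sum_embSndDeriv_eq_zero
    (hfbar : IsSmoothImmersion (𝓡 (finrank ℝ K * n - 1)) 𝓘(ℝ, Fin n → K) fbar)
    (hmin : IsMinimalAlong (m := finrank ℝ K * n - 1) projectiveMetric fbar Nbar) (x : Mbar)
    {ι : Type*} [Fintype ι] (w : ι → EuclideanSpace ℝ (Fin (finrank ℝ K * n - 1)))
    (hw : ∀ c c', ∑ i, (1 / 2 * inner ℝ (embDeriv fbar x (w i)) (embDeriv fbar x c))
        * (1 / 2 * inner ℝ (embDeriv fbar x (w i)) (embDeriv fbar x c'))
      = 1 / 2 * inner ℝ (embDeriv fbar x c) (embDeriv fbar x c')) :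
    ∑ i, 1 / 2 * inner ℝ (embSndDeriv fbar x (w i) (w i))
        (mvfderiv 𝓘(ℝ, Fin n → K) kpStarSq (fbar x) (Nbar x)) = 0 := by
  obtain ⟨b, hb, hv, h0⟩ := exists_frame_of_isMinimalAlong hfbar hmin x
  set η := mvfderiv 𝓘(ℝ, Fin n → K) kpStarSq (fbar x) (Nbar x) with hη
  let B : EuclideanSpace ℝ (Fin (finrank ℝ K * n - 1)) →ₗ[ℝ]
      EuclideanSpace ℝ (Fin (finrank ℝ K * n - 1)) →ₗ[ℝ] ℝ :=
    LinearMap.mk₂ ℝ (fun v v' => 1 / 2 * inner ℝ (embSndDeriv fbar x v v') η)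
      (fun v v' u => by rw [map_add, add_apply, inner_add_left, mul_add])
      (fun c v u => by
        rw [map_smul, smul_apply, real_inner_smul_left, smul_eq_mul]; ring)
      (fun v u u' => by rw [map_add, inner_add_left, mul_add])
      (fun c v u => by rw [map_smul, real_inner_smul_left, smul_eq_mul]; ring)
  have h := sum_bilin_eq_of_coeffs B (fun i => hv (w i)) fun j k => by rw [hw, hb]
  exact h.trans h0

variable [ChartedSpace (EuclideanSpace ℝ (Fin (finrank ℝ K * (n + 1) - 2))) (HopfPreimage fbar)]
  [IsManifold (𝓡 (finrank ℝ K * (n + 1) - 2)) ∞ (HopfPreimage fbar)]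

/-- An orthonormal frame of the preimage, with the position vector and the normal, is an orthonormal
basis of `K^{n+1}`. -/
theorem exists_orthonormalBasis_of_isOrthonormalFrameAt (hn : 1 ≤ n)
    (hNbar : IsUnitNormalField (m := finrank ℝ K * n - 1) projectiveMetric fbar Nbar)
    (hj : ContMDiff (𝓡 (finrank ℝ K * (n + 1) - 2))
      ((𝓡 (finrank ℝ K * n - 1)).prod (𝓡 (sphereDim K n))) ∞
      (fun q : HopfPreimage fbar => (q : Mbar × HSphere K n)))
    (hfbar : ContMDiff (𝓡 (finrank ℝ K * n - 1)) 𝓘(ℝ, Fin n → K) ∞ fbar) (q : HopfPreimage fbar)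
    {e : Fin (finrank ℝ K * (n + 1) - 2) → EuclideanSpace ℝ (Fin (finrank ℝ K * (n + 1) - 2))}
    (he : IsOrthonormalFrameAt (m := finrank ℝ K * (n + 1) - 2) sphereMetric (preimageMap fbar)
      q e) :
    ∃ b : OrthonormalBasis (Option (Option (Fin (finrank ℝ K * (n + 1) - 2)))) ℝ
        (EuclideanSpace K (Fin (n + 1))),
      b none = ambientMap fbar q ∧ b (some none) = ambientNormal Nbar q ∧
        ∀ i, b (some (some i)) = ambientDeriv q (e i) := by
  have hu : Orthonormal ℝ fun i => ambientDeriv q (e i) := orthonormal_iff_ite.2 he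
  have h1 : ‖ambientNormal Nbar q‖ = 1 := by
    rw [norm_eq_sqrt_real_inner, inner_ambientNormal_self hNbar, Real.sqrt_one]
  refine exists_orthonormalBasis_of_codim_two hu (norm_ambientMap q) h1
    (inner_eq_zero_of_herm_eq_zero (herm_ambientNormal q))
    (fun i => inner_toAmbient_self (preimageMap fbar q) _)
    (fun i => inner_ambientNormal hNbar hj hfbar q (e i)) ?_
  have h0 : 0 < finrank ℝ K := finrank_pos
  have h2 : finrank ℝ K * 1 ≤ finrank ℝ K * n := Nat.mul_le_mul_left _ hn
  rw [Fintype.card_fin, Fact.out (p := finrank ℝ (EuclideanSpace K (Fin (n + 1)))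
    = sphereDim K n + 1), sphereDim, mul_add]
  omega

theorem isMinimalAlong_preimageNormal (hn : 1 ≤ n)
    (hNbar : IsUnitNormalField (m := finrank ℝ K * n - 1) projectiveMetric fbar Nbar)
    (hmin : IsMinimalAlong (m := finrank ℝ K * n - 1) projectiveMetric fbar Nbar)
    (hj : ContMDiff (𝓡 (finrank ℝ K * (n + 1) - 2))
      ((𝓡 (finrank ℝ K * n - 1)).prod (𝓡 (sphereDim K n))) ∞
      (fun q : HopfPreimage fbar => (q : Mbar × HSphere K n)))
    (hfbar : IsSmoothImmersion (𝓡 (finrank ℝ K * n - 1)) 𝓘(ℝ, Fin n → K) fbar) :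
    IsMinimalAlong (m := finrank ℝ K * (n + 1) - 2) sphereMetric (preimageMap fbar)
      (preimageNormal Nbar) := by
  intro q e he
  obtain ⟨b, hbp, hba, hbu⟩ :=
    exists_orthonormalBasis_of_isOrthonormalFrameAt hn hNbar hj hfbar.1 q he
  have h1 : ∑ i, hermForm (ambientMap fbar q) (ambientNormal Nbar q)
      (ambientDeriv q (e i)) (ambientDeriv q (e i)) = 0 := by
    have h := sum_hermForm_option_eq_zero (herm_ambientNormal q) b hbp hba
    simpa only [hbu] using h
  -- The coefficients of the projected frame are `⟨uᵢ, β⟩`, with `β` the horizontal lifts of the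
  -- vectors of the other frame; these are orthogonal to `p` and `a`, so Parseval applies.
  have h2 : ∑ i, secondFundamentalForm (m := finrank ℝ K * n - 1) projectiveMetric fbar q.1.1
      (Nbar q.1.1) (projDeriv q (e i)) (projDeriv q (e i)) = 0 := by
    simp only [secondFundamentalForm_projective hfbar.1]
    refine sum_embSndDeriv_eq_zero hfbar hmin q.1.1 (fun i => projDeriv q (e i)) fun c c' => ?_
    obtain ⟨β, hβ, hc⟩ := exists_embDeriv_eq_starSqDeriv q c
    obtain ⟨γ, hγ, hc'⟩ := exists_embDeriv_eq_starSqDeriv q c'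
    have hβa : inner ℝ β (ambientNormal Nbar q) = 0 := by
      have h := inner_embDeriv_normal hNbar q.1.1 c
      rw [hc, mvfderiv_kpStarSq_normal, inner_starSqDeriv_starSqDeriv (norm_ambientMap q) _
        (herm_ambientNormal q)] at h
      linarith
    have h3 := b.sum_inner_mul_inner_option (γ := γ)
      ((congrArg _ hbp).trans (inner_eq_zero_of_herm_eq_zero hβ)) ((congrArg _ hba).trans hβa)
    have h4 : ∀ {δ} (_ : herm δ (ambientMap fbar q) = 0) (y : EuclideanSpace K (Fin (n + 1))),
        1 / 2 * inner ℝ (starSqDeriv (ambientMap fbar q) y) (starSqDeriv (ambientMap fbar q) δ)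
          = inner ℝ y δ := by
      intro δ hδ y
      rw [inner_starSqDeriv_starSqDeriv (norm_ambientMap q) _ hδ]
      ring
    have h5 : ∀ i, embDeriv fbar q.1.1 (projDeriv q (e i))
        = starSqDeriv (ambientMap fbar q) (ambientDeriv q (e i)) := fun i =>
      embDeriv_projDeriv hj hfbar.1 q (e i)
    simp only [hbu] at h3
    simp only [h5, hc, hc', h4 hβ, h4 hγ]
    exact h3
  have h3 : ∀ i, secondFundamentalForm (m := finrank ℝ K * (n + 1) - 2) sphereMetric
      (preimageMap fbar) q (preimageNormal Nbar q) (e i) (e i)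
      = secondFundamentalForm (m := finrank ℝ K * n - 1) projectiveMetric fbar q.1.1
        (Nbar q.1.1) (projDeriv q (e i)) (projDeriv q (e i))
        - 2 * hermForm (ambientMap fbar q) (ambientNormal Nbar q)
      (ambientDeriv q (e i)) (ambientDeriv q (e i)) := fun i =>
    eq_sub_of_add_eq (secondFundamentalForm_proj hNbar hj hfbar.1 q (e i)).symm
  rw [Finset.sum_congr rfl fun i _ => h3 i, Finset.sum_sub_distrib, ← Finset.mul_sum, h1, h2]
  norm_num

end Minimality

/-! ### The preimage as a topological space -/

section Preimage

variable {K : Type*} [NormedDivisionRing K] [InnerProductSpace ℝ K] [HopfScalars K] {n : ℕ}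
  {Mbar : Type*} {fbar : Mbar → KP K n}

theorem range_preimageMap : range (preimageMap fbar) = hopf ⁻¹' range fbar := by
  ext p
  constructor
  · rintro ⟨q, rfl⟩
    exact ⟨q.1.1, q.2⟩
  · rintro ⟨x, hx⟩
    exact ⟨⟨(x, p), hx⟩, rfl⟩

theorem compactSpace_hopfPreimage [TopologicalSpace Mbar] [CompactSpace Mbar]
    (hf : Continuous fbar) : CompactSpace (HopfPreimage fbar) := by
  have _ : ProperSpace (EuclideanSpace K (Fin (n + 1))) := FiniteDimensional.proper ℝ _
  have hc : IsClosed {q : Mbar × HSphere K n | fbar q.1 = hopf q.2} :=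
    isClosed_eq (hf.comp continuous_fst) (continuous_hopf.comp continuous_snd)
  exact isCompact_iff_compactSpace.1 hc.isCompact

end Preimage

theorem mainTheorem4 {K : Type*} [NormedDivisionRing K] [InnerProductSpace ℝ K] [HopfScalars K]
    (n : ℕ) (hn : 1 ≤ n)
    {Mbar : Type*} [TopologicalSpace Mbar] [T2Space Mbar] [CompactSpace Mbar]
    [ChartedSpace (EuclideanSpace ℝ (Fin (finrank ℝ K * n - 1))) Mbar]
    [IsManifold (𝓡 (finrank ℝ K * n - 1)) ∞ Mbar]
    (fbar : Mbar → KP K n)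
    (hfbar : IsSmoothImmersion (𝓡 (finrank ℝ K * n - 1)) 𝓘(ℝ, Fin n → K) fbar)
    (Nbar : ∀ x : Mbar, TangentSpace 𝓘(ℝ, Fin n → K) (fbar x))
    (hNbar : IsUnitNormalField (m := finrank ℝ K * n - 1) projectiveMetric fbar Nbar)
    (hmin : IsMinimalAlong (m := finrank ℝ K * n - 1) projectiveMetric fbar Nbar) :
    T2Space (HopfPreimage fbar) ∧ CompactSpace (HopfPreimage fbar) ∧
    range (preimageMap fbar) = hopf ⁻¹' range fbar ∧
    hopf '' range (preimageMap fbar) = range fbar ∧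
    ∃ (_ : ChartedSpace (EuclideanSpace ℝ (Fin (finrank ℝ K * (n + 1) - 2))) (HopfPreimage fbar))
      (_ : IsManifold (𝓡 (finrank ℝ K * (n + 1) - 2)) ∞ (HopfPreimage fbar)),
      IsSmoothImmersion (𝓡 (finrank ℝ K * (n + 1) - 2))
        ((𝓡 (finrank ℝ K * n - 1)).prod (𝓡 (sphereDim K n)))
        (fun q : HopfPreimage fbar => (q : Mbar × HSphere K n)) ∧
      IsSmoothImmersion (𝓡 (finrank ℝ K * (n + 1) - 2)) (𝓡 (sphereDim K n)) (preimageMap fbar) ∧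
      ∃ N : ∀ q : HopfPreimage fbar, TangentSpace (𝓡 (sphereDim K n)) (preimageMap fbar q),
        IsUnitNormalField (m := finrank ℝ K * (n + 1) - 2) sphereMetric (preimageMap fbar) N ∧
        IsMinimalAlong (m := finrank ℝ K * (n + 1) - 2) sphereMetric (preimageMap fbar) N := by
  have hc : Continuous fbar := hfbar.1.continuous
  refine ⟨inferInstance, compactSpace_hopfPreimage hc, range_preimageMap, ?_, ?_⟩
  · rw [range_preimageMap, image_preimage_eq _ hopf_surjective]
  -- At `q`, use the coordinate that defines the preferred chart of the projective space.
  let idx : HopfPreimage fbar → Fin (n + 1) × Mbar × sphere (0 : K) 1 := fun q =>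
    (chartIndex (hopf q.1.2), trivMap (chartIndex (hopf q.1.2)) (q : Mbar × HSphere K n))
  have h : ∀ q, q ∈ (preimageChart hn hc (idx q)).source := fun q =>
    (mem_preimageChart_source hn hc _ q).2 ⟨coord_chartIndex_ne_zero q.1.2, mem_chart_source _ _⟩
  have hs := contMDiffOn_preimageChart_symm hn hfbar.1
  have hr : ∀ a, ∀ q ∈ (preimageChart hn hc a).source,
      ContMDiffAt ((𝓡 (finrank ℝ K * n - 1)).prod (𝓡 (sphereDim K n)))
      (𝓡 (finrank ℝ K * (n + 1) - 2)) ∞ (preimageCoord hn a) (q : Mbar × HSphere K n) :=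
    fun a q hq => contMDiffAt_preimageCoord hn hc a hq
  have hφ : ∀ a, ∀ q ∈ (preimageChart hn hc a).source,
      preimageChart hn hc a q = preimageCoord hn a (q : Mbar × HSphere K n) := fun _ _ _ => rfl
  let _ := chartedSpaceOfCharts (preimageChart hn hc) idx h
  have hM := isManifold_chartedSpaceOfCharts idx h hs hr hφ
  have hj := isSmoothImmersion_chartedSpaceOfCharts idx h hs hr hφ
  exact ⟨_, hM, hj, isSmoothImmersion_preimageMap hj hfbar, preimageNormal Nbar,
    isUnitNormalField_preimageNormal hNbar hj.1 hfbar.1,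
    isMinimalAlong_preimageNormal hn hNbar hmin hj.1 hfbar⟩
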